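/- Let $\Delta=\{z\in\mathbb C:|z|<1\}$ and let $g_\Delta$ be the Poincaré metric on $\Delta$ of constant Gaussian curvature $-2$, i.e. $g_\Delta = 2|dz|^2/(1-|z|^2)^2$. Let $\lambda_1,\lambda_2>0$ be real constants, and let $f=(f_1,f_2):(\Delta,g_\Delta)\to(\Delta,\lambda_1 g_\Delta)\times(\Delta,\lambda_2 g_\Delta)$ be a holomorphic isometry, that is, a holomorphic map $f:\Delta\to\Delta^2$ with $\lambda_1 f_1^*g_\Delta+\lambda_2 f_2^*g_\Delta=g_\Delta$. Two such holomorphic isometries $F,G$ (with the same constants $\lambda_1,\lambda_2$) are said to be equal up to reparametrizations if $F=\Psi\circ G\circ\phi$ for some biholomorphic automorphisms $\phi\in\mathrm{Aut}(\Delta)$ and $\Psi\in\mathrm{Aut}(\Delta^2)$. Then, up to reparametrizations, $f$ is one of the following holomorphic isometries: 1. $z\mapsto(z,0)$, with $\lambda_1=1$ and $\lambda_2>0$ arbitrary; 2. $z\mapsto(0,z)$, with $\lambda_2=1$ and $\lambda_1>0$ arbitrary; 3. $z\mapsto(z,z)$, with $\lambda_1+\lambda_2=1$; 4. the square root embedding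 $F_2:\Delta\to\Delta^2$, with $\lambda_1=\lambda_2=1$. Here $F_2(z)=\big(c(\sqrt{\tau}),\,c(i\sqrt{\tau})\big)$ with $\tau=i\,\frac{1+z}{1-z}$ in the upper half-plane, $c(w)=\frac{w-i}{w+i}$, and $\sqrt{\tau}=r^{1/2}e^{i\theta/2}$ for $\tau=re^{i\theta}$, $0<\theta<\pi$. -/

import Mathlib

noncomputable section

namespace DiskIsometry

/-- The open unit disk `Δ` in `ℂ`. -/
def disk : Set ℂ := Metric.ball (0 : ℂ) 1

/-- The bidisk `Δ × Δ` in `ℂ × ℂ`. -/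
def bidisk : Set (ℂ × ℂ) := disk ×ˢ disk

/-- The Poincaré metric `g_Δ` of constant Gaussian curvature `-2` on the unit disk,
`g_Δ = 2 |dz|² / (1 - |z|²)²`, evaluated at the point `z` on tangent vectors `u`, `v`. -/
def poincareMetric (z u v : ℂ) : ℝ :=
  2 * (u * (starRingEnd ℂ) v).re / (1 - ‖z‖ ^ 2) ^ 2

/-- The product metric `l₁ g_Δ ⊕ l₂ g_Δ` on the bidisk, evaluated at the point `p` on tangent
vectors `u`, `v`. -/
def bidiskMetric (l₁ l₂ : ℝ) (p u v : ℂ × ℂ) : ℝ :=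
  l₁ * poincareMetric p.1 u.1 v.1 + l₂ * poincareMetric p.2 u.2 v.2

/-- `F` restricts to a holomorphic isometry `(Δ, g_Δ) → (Δ, l₁ g_Δ) × (Δ, l₂ g_Δ)`: it is
holomorphic on the disk, maps it into the bidisk, and pulls the product metric back to `g_Δ`.
Values of `F` outside the disk are irrelevant. -/
structure IsHolomorphicIsometry (l₁ l₂ : ℝ) (F : ℂ → ℂ × ℂ) : Prop where
  holomorphic : DifferentiableOn ℂ F disk
  mapsTo : Set.MapsTo F disk bidisk
  pullback : ∀ z ∈ disk, ∀ u v : ℂ,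
    bidiskMetric l₁ l₂ (F z) (fderiv ℂ F z u) (fderiv ℂ F z v) = poincareMetric z u v

/-- `φ` restricts to a holomorphic automorphism of the domain `U`, i.e. to an element of
`Aut(U)`: a holomorphic self-map of `U` with a holomorphic inverse. -/
def IsHolomorphicAut {E : Type*} [NormedAddCommGroup E] [NormedSpace ℂ E]
    (U : Set E) (φ : E → E) : Prop :=
  DifferentiableOn ℂ φ U ∧ Set.MapsTo φ U U ∧
    ∃ ψ : E → E, DifferentiableOn ℂ ψ U ∧ Set.MapsTo ψ U U ∧
      Set.LeftInvOn ψ φ U ∧ Set.RightInvOn ψ φ U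

/-- The holomorphic isometries `F` and `G` from `(Δ, g_Δ)` to `(Δ, l₁ g_Δ) × (Δ, l₂ g_Δ)` are
equal up to reparametrizations: `F = Ψ ∘ G ∘ φ` on `Δ` for some `φ ∈ Aut(Δ)`, `Ψ ∈ Aut(Δ²)`. -/
structure EqUpToReparam (l₁ l₂ : ℝ) (F G : ℂ → ℂ × ℂ) : Prop where
  isometry_left : IsHolomorphicIsometry l₁ l₂ F
  isometry_right : IsHolomorphicIsometry l₁ l₂ G
  exists_aut : ∃ (φ : ℂ → ℂ) (Ψ : ℂ × ℂ → ℂ × ℂ),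
    IsHolomorphicAut disk φ ∧ IsHolomorphicAut bidisk Ψ ∧ Set.EqOn F (Ψ ∘ G ∘ φ) disk

/-- The Cayley transform from the unit disk onto the upper half-plane. -/
def toHalfPlane (z : ℂ) : ℂ := Complex.I * (1 + z) / (1 - z)

/-- The Cayley transform from the upper half-plane onto the unit disk. -/
def toDisk (w : ℂ) : ℂ := (w - Complex.I) / (w + Complex.I)

/-- The map `τ ↦ (τ^(1/2), γ τ^(1/2))`, `γ = e^(π i / 2)`, from the upper half-plane to its square,
where `τ^(1/2) = r^(1/2) e^(i θ / 2)` for `τ = r e^(i θ)` with `0 < θ < π`. -/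
def halfPlaneSqrt (τ : ℂ) : ℂ × ℂ :=
  (τ ^ (1 / 2 : ℂ), Complex.exp (Real.pi * Complex.I / 2) * τ ^ (1 / 2 : ℂ))

/-- The square root embedding `F₂ : Δ → Δ²`, obtained from `halfPlaneSqrt` by composing with
Cayley transforms. -/
def sqrtEmbedding (z : ℂ) : ℂ × ℂ :=
  (toDisk (halfPlaneSqrt (toHalfPlane z)).1, toDisk (halfPlaneSqrt (toHalfPlane z)).2)

end DiskIsometry

end

noncomputable section

namespace DiskIsometry

open Complex Metric Filter Topology ComplexConjugate

/-! The proof reduces the metric identity to polynomial relations between the components and then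
studies those relations algebraically. Möbius involutions in source and target make the isometry (f,
g) fix the origin (`IsIsometryPair.center`). The metric identity is real-analytic, so it polarizes
to an identity holomorphic in (z, ζ), where conj z becomes the independent variable ζ
(`IsCenteredIsometry.polarized`). It can be integrated explicitly in z
(`IsCenteredIsometry.integrated`). The Taylor coefficients in ζ of orders 0, 1, 2 give a linear, a
quadratic and a cubic relation between f(z), g(z) and z (`IsCenteredIsometry.expansion`).

If f'(0) = 0 or g'(0) = 0, that component vanishes and the other is a rotation. If both derivatives
are nonzero but f''(0) = 0, both components are rotations and l₁ + l₂ = 1. In the remaining case,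
write the normalized first component as pz + D. The quadratic relation says that D is quadratic over
ℂ[z] with a discriminant that is not a square. Dividing the cubic relation by the quadratic one
leaves a relation linear in D, so all coefficients of the remainder vanish
(`linear_relation_trivial`), and this forces l₁ = l₂ = 1 (`weights_eq_one`).

With unit weights the quadratic relation alone determines f from its 2-jet at the origin, and
|f''(0)| is a function of |f'(0)|. Up to rotations the only invariant is therefore |f'(0)|² in (0,
1) (`IsCenteredIsometry.eq_up_to_rotation`). Recentring the square root embedding at suitable points
realizes every such value (`exists_sqrt_share`), so every such isometry is a reparametrization of
it. -/

/-! ### Polarization and integration of the metric identity -/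

/-- A function of two complex variables that is holomorphic on the bidisk and vanishes on the
antidiagonal `ζ = conj z` vanishes near the origin. -/
theorem eq_zero_of_eq_zero_on_conj {H : ℂ × ℂ → ℂ} (hH : DifferentiableOn ℂ H bidisk)
    (h0 : ∀ z ∈ disk, H (z, conj z) = 0) {z ζ : ℂ} (hz : z ∈ ball (0 : ℂ) (1 / 2))
    (hζ : ζ ∈ ball (0 : ℂ) (1 / 2)) : H (z, ζ) = 0 := by
  have hopen : IsOpen bidisk := isOpen_ball.prod isOpen_ball
  -- In the coordinates z = a + ib, ζ = a - ib the antidiagonal is the locus where a and b are real.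
  -- Real points accumulate at 0, so the one-variable identity theorem applies first in a for real
  -- b, then in b.
  have mem : ∀ a ∈ ball (0 : ℂ) (1 / 2), ∀ b ∈ ball (0 : ℂ) (1 / 2),
      (a + I * b, a - I * b) ∈ bidisk := by
    intro a ha b hb
    simp only [bidisk, disk, Set.mem_prod, mem_ball_zero_iff] at *
    constructor
    · calc ‖a + I * b‖ ≤ ‖a‖ + ‖I * b‖ := norm_add_le _ _
        _ < 1 := by rw [norm_mul, norm_I]; linarith
    · calc ‖a - I * b‖ ≤ ‖a‖ + ‖I * b‖ := norm_sub_le _ _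
        _ < 1 := by rw [norm_mul, norm_I]; linarith
  have freq : ∀ k : ℂ → ℂ, DifferentiableOn ℂ k (ball 0 (1 / 2)) →
      (∀ r : ℝ, (r : ℂ) ∈ ball (0 : ℂ) (1 / 2) → k r = 0) →
      ∀ a ∈ ball (0 : ℂ) (1 / 2), k a = 0 := by
    intro k hk hr
    have hmem : (0 : ℂ) ∈ ball (0 : ℂ) (1 / 2) := mem_ball_self (by norm_num)
    refine (hk.analyticOnNhd isOpen_ball).eqOn_zero_of_preconnected_of_frequently_eq_zero
      (convex_ball _ _).isPreconnected hmem ?_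
    have htend : Tendsto (fun r : ℝ => (r : ℂ)) (𝓝[≠] 0) (𝓝[≠] 0) := by
      refine tendsto_nhdsWithin_iff.2 ⟨?_, ?_⟩
      · exact (continuous_ofReal.tendsto' 0 0 ofReal_zero).mono_left nhdsWithin_le_nhds
      · filter_upwards [self_mem_nhdsWithin] with r hr
        simpa using hr
    refine htend.frequently (Eventually.frequently ?_)
    have := (continuous_ofReal.tendsto 0).eventually (isOpen_ball.mem_nhds (by simp) :
      ball (0 : ℂ) (1 / 2) ∈ 𝓝 _)
    filter_upwards [nhdsWithin_le_nhds this] with r h using hr r h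
  have diff : ∀ b ∈ ball (0 : ℂ) (1 / 2), DifferentiableOn ℂ
      (fun a => H (a + I * b, a - I * b)) (ball 0 (1 / 2)) := fun b hb a ha =>
    ((hH.differentiableAt (hopen.mem_nhds (mem a ha b hb))).comp a
      (f := fun a => (a + I * b, a - I * b)) (by fun_prop)).differentiableWithinAt
  have diff' : ∀ a ∈ ball (0 : ℂ) (1 / 2), DifferentiableOn ℂ
      (fun b => H (a + I * b, a - I * b)) (ball 0 (1 / 2)) := fun a ha b hb =>
    ((hH.differentiableAt (hopen.mem_nhds (mem a ha b hb))).comp b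
      (f := fun b => (a + I * b, a - I * b)) (by fun_prop)).differentiableWithinAt
  have real_b : ∀ s : ℝ, (s : ℂ) ∈ ball (0 : ℂ) (1 / 2) → ∀ a ∈ ball (0 : ℂ) (1 / 2),
      H (a + I * s, a - I * s) = 0 := by
    intro s hs
    refine freq _ (diff s hs) fun r hr => ?_
    have := h0 _ (mem r hr s hs).1
    simpa [sub_eq_add_neg] using this
  have all : ∀ a ∈ ball (0 : ℂ) (1 / 2), ∀ b ∈ ball (0 : ℂ) (1 / 2),
      H (a + I * b, a - I * b) = 0 := fun a ha =>
    freq _ (diff' a ha) fun s hs => real_b s hs a ha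
  have ha : (z + ζ) / 2 ∈ ball (0 : ℂ) (1 / 2) := by
    simp only [mem_ball_zero_iff] at *
    have := norm_add_le z ζ
    rw [norm_div, Complex.norm_ofNat]; linarith
  have hb : -I * ((z - ζ) / 2) ∈ ball (0 : ℂ) (1 / 2) := by
    simp only [mem_ball_zero_iff] at *
    have := norm_sub_le z ζ
    rw [norm_mul, norm_neg, norm_I, norm_div, Complex.norm_ofNat]; linarith
  have := all _ ha _ hb
  have e : I * (-I * ((z - ζ) / 2)) = (z - ζ) / 2 := by
    linear_combination (-(z - ζ) / 2) * I_mul_I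
  rw [e] at this
  convert this using 3 <;> ring

/-- The pair `(f, g)` is a holomorphic isometry of the disk into the bidisk, expressed through its
components. -/
structure IsIsometryPair (l₁ l₂ : ℝ) (f g : ℂ → ℂ) : Prop where
  diff₁ : DifferentiableOn ℂ f disk
  diff₂ : DifferentiableOn ℂ g disk
  mapsTo₁ : Set.MapsTo f disk disk
  mapsTo₂ : Set.MapsTo g disk disk
  metric : ∀ z ∈ disk, l₁ * ‖deriv f z‖ ^ 2 / (1 - ‖f z‖ ^ 2) ^ 2 +
    l₂ * ‖deriv g z‖ ^ 2 / (1 - ‖g z‖ ^ 2) ^ 2 = 1 / (1 - ‖z‖ ^ 2) ^ 2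

/-- An isometry `(f, g)` of the disk into the bidisk that fixes the origin. -/
structure IsCenteredIsometry (l₁ l₂ : ℝ) (f g : ℂ → ℂ) : Prop extends
    IsIsometryPair l₁ l₂ f g where
  zero₁ : f 0 = 0
  zero₂ : g 0 = 0

/-- The reflection `ζ ↦ conj (f (conj ζ))`. -/
def reflect (f : ℂ → ℂ) (ζ : ℂ) : ℂ := conj (f (conj ζ))

theorem conj_mem_disk {z : ℂ} (hz : z ∈ disk) : conj z ∈ disk := by
  simpa [disk] using hz

theorem isOpen_disk : IsOpen disk := isOpen_ball

theorem zero_mem_disk : (0 : ℂ) ∈ disk := mem_ball_self one_pos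

theorem disk_mem_nhds {z : ℂ} (hz : z ∈ disk) : disk ∈ 𝓝 z := isOpen_disk.mem_nhds hz

theorem deriv_reflect (f : ℂ → ℂ) : deriv (reflect f) = reflect (deriv f) := by
  exact deriv_conj_conj

theorem differentiableOn_reflect {f : ℂ → ℂ} (hf : DifferentiableOn ℂ f disk) :
    DifferentiableOn ℂ (reflect f) disk := by
  intro ζ hζ
  have := (hf.differentiableAt (disk_mem_nhds (conj_mem_disk hζ))).conj_conj
  rw [conj_conj] at this
  exact this.differentiableWithinAt

theorem mapsTo_reflect {f : ℂ → ℂ} (hf : Set.MapsTo f disk disk) :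
    Set.MapsTo (reflect f) disk disk :=
  fun _ hζ => conj_mem_disk (hf (conj_mem_disk hζ))

theorem one_sub_mul_ne_zero {z w : ℂ} (hz : z ∈ disk) (hw : w ∈ disk) : 1 - z * w ≠ 0 := by
  intro h
  have h1 : ‖z * w‖ = 1 := by rw [← sub_eq_zero.1 h, norm_one]
  simp only [disk, mem_ball_zero_iff] at hz hw
  rw [norm_mul] at h1
  nlinarith [norm_nonneg z, norm_nonneg w]

theorem one_sub_normSq_pos {z : ℂ} (hz : z ∈ disk) : 0 < 1 - ‖z‖ ^ 2 := by
  simp only [disk, mem_ball_zero_iff] at hz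
  nlinarith [norm_nonneg z]

theorem half_subset_disk : ball (0 : ℂ) (1 / 2) ⊆ disk := ball_subset_ball (by norm_num)

/-- At ζ = conj z this is the metric identity, since `reflect f (conj z) = conj (f z)`. Both sides
are holomorphic in (z, ζ), so agreement on the antidiagonal propagates. -/
theorem IsCenteredIsometry.polarized {l₁ l₂ : ℝ} {f g : ℂ → ℂ}
    (h : IsCenteredIsometry l₁ l₂ f g) {z ζ : ℂ} (hz : z ∈ ball (0 : ℂ) (1 / 2))
    (hζ : ζ ∈ ball (0 : ℂ) (1 / 2)) :
    l₁ * (deriv f z * deriv (reflect f) ζ) / (1 - f z * reflect f ζ) ^ 2 +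
    l₂ * (deriv g z * deriv (reflect g) ζ) / (1 - g z * reflect g ζ) ^ 2
      = 1 / (1 - z * ζ) ^ 2 := by
  rw [← sub_eq_zero]
  refine eq_zero_of_eq_zero_on_conj (H := fun w =>
    l₁ * (deriv f w.1 * deriv (reflect f) w.2) / (1 - f w.1 * reflect f w.2) ^ 2 +
    l₂ * (deriv g w.1 * deriv (reflect g) w.2) / (1 - g w.1 * reflect g w.2) ^ 2
      - 1 / (1 - w.1 * w.2) ^ 2) ?_ ?_ hz hζ
  · have fst : ∀ k : ℂ → ℂ, DifferentiableOn ℂ k disk →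
        DifferentiableOn ℂ (fun w : ℂ × ℂ => k w.1) bidisk := fun k hk =>
      hk.comp differentiableOn_fst fun w hw => hw.1
    have snd : ∀ k : ℂ → ℂ, DifferentiableOn ℂ k disk →
        DifferentiableOn ℂ (fun w : ℂ × ℂ => k w.2) bidisk := fun k hk =>
      hk.comp differentiableOn_snd fun w hw => hw.2
    have term : ∀ (l : ℂ) (k : ℂ → ℂ), DifferentiableOn ℂ k disk → Set.MapsTo k disk disk →
        DifferentiableOn ℂ (fun w : ℂ × ℂ => l * (deriv k w.1 * deriv (reflect k) w.2) /
          (1 - k w.1 * reflect k w.2) ^ 2) bidisk := by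
      intro l k hk hm
      have hr := differentiableOn_reflect hk
      simp only [div_eq_mul_inv]
      refine DifferentiableOn.fun_mul ?_ (DifferentiableOn.fun_inv ?_ ?_)
      · exact ((fst _ (hk.deriv isOpen_disk)).mul (snd _ (hr.deriv isOpen_disk))).const_mul l
      · exact (((fst _ hk).mul (snd _ hr)).const_sub 1).pow 2
      · exact fun w hw => pow_ne_zero 2
          (one_sub_mul_ne_zero (hm hw.1) (mapsTo_reflect hm hw.2))
    refine ((term _ _ h.diff₁ h.mapsTo₁).add (term _ _ h.diff₂ h.mapsTo₂)).sub ?_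
    simp only [one_div]
    refine DifferentiableOn.fun_inv ?_ ?_
    · fun_prop
    · exact fun w hw => pow_ne_zero 2 (one_sub_mul_ne_zero hw.1 hw.2)
  · intro w hw
    have := congrArg (fun r : ℝ => (r : ℂ)) (h.metric w hw)
    simp only [deriv_reflect, reflect, conj_conj, mul_conj, normSq_eq_norm_sq]
    push_cast at this ⊢
    rw [this, sub_self]

/-- For fixed ζ, each term of the polarized identity has an explicit primitive in z: the derivative
of kc/(1 - kr) is k'c/(1 - kr)². All primitives vanish at z = 0 because the isometry is centered. -/
theorem IsCenteredIsometry.integrated {l₁ l₂ : ℝ} {f g : ℂ → ℂ}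
    (h : IsCenteredIsometry l₁ l₂ f g) {z ζ : ℂ} (hz : z ∈ ball (0 : ℂ) (1 / 2))
    (hζ : ζ ∈ ball (0 : ℂ) (1 / 2)) :
    l₁ * (f z * deriv (reflect f) ζ / (1 - f z * reflect f ζ)) +
    l₂ * (g z * deriv (reflect g) ζ / (1 - g z * reflect g ζ))
      = z / (1 - z * ζ) := by
  have hζ' := half_subset_disk hζ
  have term : ∀ k : ℂ → ℂ, DifferentiableOn ℂ k disk → Set.MapsTo k disk disk → ∀ (c : ℂ),
      ∀ w ∈ disk, ∀ r ∈ disk, HasDerivAt (fun w => k w * c / (1 - k w * r))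
        (deriv k w * c / (1 - k w * r) ^ 2) w := by
    intro k hk hm c w hw r hr
    have hd := (hk.differentiableAt (disk_mem_nhds hw)).hasDerivAt
    have hne := one_sub_mul_ne_zero (hm hw) hr
    refine ((hd.mul_const c).div ((hd.mul_const r).const_sub 1) hne).congr_deriv ?_
    congr 1
    ring
  set Φ : ℂ → ℂ := fun w => l₁ * (f w * deriv (reflect f) ζ / (1 - f w * reflect f ζ)) +
    l₂ * (g w * deriv (reflect g) ζ / (1 - g w * reflect g ζ)) - w / (1 - w * ζ) with hΦ
  have key : ∀ w ∈ ball (0 : ℂ) (1 / 2), HasDerivAt Φ 0 w := by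
    intro w hw
    have hw' := half_subset_disk hw
    have hid := term id differentiableOn_id (fun _ hx => hx) 1 w hw' ζ hζ'
    simp only [id, mul_one, deriv_id] at hid
    have := (((term f h.diff₁ h.mapsTo₁ (deriv (reflect f) ζ) w hw' _
      (mapsTo_reflect h.mapsTo₁ hζ')).const_mul (l₁ : ℂ)).add
      ((term g h.diff₂ h.mapsTo₂ (deriv (reflect g) ζ) w hw' _
      (mapsTo_reflect h.mapsTo₂ hζ')).const_mul (l₂ : ℂ))).sub hid
    refine this.congr_deriv ?_
    have hp := h.polarized hw hζ
    rw [sub_eq_zero, ← hp]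
    ring
  have hc := isOpen_ball.is_const_of_deriv_eq_zero (f := Φ) (convex_ball (0 : ℂ) (1 / 2)).isPreconnected
    (fun w hw => (key w hw).differentiableAt.differentiableWithinAt)
    (fun w hw => (key w hw).deriv) hz (mem_ball_self (by norm_num))
  simp only [hΦ, h.zero₁, h.zero₂] at hc
  rw [← sub_eq_zero, hc]
  simp

/-! ### Polynomial relations from the expansion in ζ -/

/-- The first three Taylor coefficients at the origin of `F k' / (1 - F k)`. -/
theorem deriv_logarithmic {k : ℂ → ℂ} (hk : AnalyticAt ℂ k 0) (h0 : k 0 = 0) (F : ℂ) :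
    ∃ G₁ G₂ : ℂ → ℂ, (∀ᶠ ζ in 𝓝 0, HasDerivAt (fun ζ => F * deriv k ζ / (1 - F * k ζ)) (G₁ ζ) ζ) ∧
      HasDerivAt G₁ (G₂ 0) 0 ∧
      G₁ 0 = F * deriv (deriv k) 0 + F ^ 2 * deriv k 0 ^ 2 ∧
      G₂ 0 = F * deriv (deriv (deriv k)) 0 + 3 * F ^ 2 * deriv k 0 * deriv (deriv k) 0 +
        2 * F ^ 3 * deriv k 0 ^ 3 := by
  have hk1 := hk.deriv
  have hk2 := hk1.deriv
  have hne : ∀ᶠ ζ in 𝓝 (0 : ℂ), 1 - F * k ζ ≠ 0 := by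
    have : ContinuousAt (fun ζ => 1 - F * k ζ) 0 := by
      have := hk.continuousAt
      fun_prop
    exact this.eventually_ne (by simp [h0])
  refine ⟨fun ζ => F * deriv (deriv k) ζ / (1 - F * k ζ) + (F * deriv k ζ / (1 - F * k ζ)) ^ 2,
    -- A constant function suffices as `G₂`: only its value at 0 is used.
    fun ζ => F * deriv (deriv (deriv k)) 0 + 3 * F ^ 2 * deriv k 0 * deriv (deriv k) 0 +
        2 * F ^ 3 * deriv k 0 ^ 3, ?_, ?_, ?_, rfl⟩
  · filter_upwards [hne, hk.eventually_analyticAt, hk1.eventually_analyticAt] with ζ h1 h2 h3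
    refine ((h3.differentiableAt.hasDerivAt.const_mul F).div
      ((h2.differentiableAt.hasDerivAt.const_mul F).const_sub 1) h1).congr_deriv ?_
    field_simp
    ring
  · have h1 := hne.self_of_nhds
    have hd := hk.differentiableAt.hasDerivAt
    have hd1 := hk1.differentiableAt.hasDerivAt
    have hd2 := hk2.differentiableAt.hasDerivAt
    refine (((hd2.const_mul F).div ((hd.const_mul F).const_sub 1) h1).add
      (((hd1.const_mul F).div ((hd.const_mul F).const_sub 1) h1).pow 2)).congr_deriv ?_
    simp [h0]
    ring
  · simp [h0]
    ring

/-- These are the derivatives in ζ of orders 0, 1, 2 of the integrated identity at ζ = 0, with z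
fixed. There the derivatives of the reflected components are the conjugates of those of f and g. -/
theorem IsCenteredIsometry.expansion {l₁ l₂ : ℝ} {f g : ℂ → ℂ}
    (h : IsCenteredIsometry l₁ l₂ f g) {z : ℂ} (hz : z ∈ ball (0 : ℂ) (1 / 2)) :
    l₁ * (conj (deriv f 0) * f z) + l₂ * (conj (deriv g 0) * g z) = z ∧
    l₁ * (conj (deriv (deriv f) 0) * f z + conj (deriv f 0) ^ 2 * f z ^ 2) +
      l₂ * (conj (deriv (deriv g) 0) * g z + conj (deriv g 0) ^ 2 * g z ^ 2) = z ^ 2 ∧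
    l₁ * (conj (deriv (deriv (deriv f)) 0) * f z +
        3 * conj (deriv f 0) * conj (deriv (deriv f) 0) * f z ^ 2 +
        2 * conj (deriv f 0) ^ 3 * f z ^ 3) +
      l₂ * (conj (deriv (deriv (deriv g)) 0) * g z +
        3 * conj (deriv g 0) * conj (deriv (deriv g) 0) * g z ^ 2 +
        2 * conj (deriv g 0) ^ 3 * g z ^ 3) = 2 * z ^ 3 := by
  have hr0 : ∀ k : ℂ → ℂ, reflect k 0 = conj (k 0) := by simp [reflect]
  have hf := (differentiableOn_reflect h.diff₁).analyticAt (disk_mem_nhds zero_mem_disk)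
  have hg := (differentiableOn_reflect h.diff₂).analyticAt (disk_mem_nhds zero_mem_disk)
  obtain ⟨F₁, F₂, hF, hF', hF1, hF2⟩ := deriv_logarithmic hf (by simp [hr0, h.zero₁]) (f z)
  obtain ⟨G₁, G₂, hG, hG', hG1, hG2⟩ := deriv_logarithmic hg (by simp [hr0, h.zero₂]) (g z)
  obtain ⟨H₁, H₂, hH, hH', hH1, hH2⟩ := deriv_logarithmic (k := fun w => w) analyticAt_id rfl z
  have hball : ∀ᶠ ζ in 𝓝 (0 : ℂ), ζ ∈ ball (0 : ℂ) (1 / 2) :=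
    ball_mem_nhds _ (by norm_num)
  have eq0 : (fun ζ => l₁ * (f z * deriv (reflect f) ζ / (1 - f z * reflect f ζ)) +
      l₂ * (g z * deriv (reflect g) ζ / (1 - g z * reflect g ζ))) =ᶠ[𝓝 0]
      fun ζ => z * deriv (fun w => w) ζ / (1 - z * ζ) := by
    filter_upwards [hball] with ζ hζ
    rw [h.integrated hz hζ]
    simp
  have eq1 : (fun ζ => l₁ * F₁ ζ + l₂ * G₁ ζ) =ᶠ[𝓝 0] H₁ := by
    filter_upwards [eq0.eventually_nhds, hF, hG, hH] with ζ h1 h2 h3 h4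
    exact (((h2.const_mul (l₁ : ℂ)).add (h3.const_mul (l₂ : ℂ))).congr_of_eventuallyEq
      (EventuallyEq.symm h1)).unique h4
  have eq2 : l₁ * F₂ 0 + l₂ * G₂ 0 = H₂ 0 :=
    (((hF'.const_mul (l₁ : ℂ)).add (hG'.const_mul (l₂ : ℂ))).congr_of_eventuallyEq
      eq1.symm).unique hH'
  have eq0' := eq0.self_of_nhds
  have eq1' := eq1.self_of_nhds
  simp only [deriv_reflect, hr0, h.zero₁, h.zero₂] at eq0' eq1' eq2 hF1 hF2 hG1 hG2
  simp at eq0' hH1 hH2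
  rw [hF1, hG1, hH1] at eq1'
  rw [hF2, hG2, hH2] at eq2
  refine ⟨?_, ?_, ?_⟩
  · linear_combination eq0'
  · linear_combination eq1'
  · linear_combination eq2

/-! ### Algebra of the quadratic and cubic relations -/

/-- A function satisfying a quadratic equation over `ℂ[z]` whose discriminant is not a square
satisfies no nontrivial linear equation over `ℂ[z]`. -/
theorem linear_relation_trivial {κ e t m : ℂ} (hκ : κ ≠ 0) (ht : t ≠ 0) (hm : m ≠ 0)
    {D : ℂ → ℂ} (hD : ∀ᶠ z in 𝓝 0, κ * D z ^ 2 + 2 * (e * z + t) * D z - m * z ^ 2 = 0)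
    {P R : Polynomial ℂ} (hPR : ∀ᶠ z in 𝓝 0, P.eval z * D z + R.eval z = 0) :
    P = 0 ∧ R = 0 := by
  open Polynomial in
  have inf : ∀ {U V : ℂ[X]}, (∀ᶠ z in 𝓝 (0 : ℂ), U.eval z = V.eval z) → U = V := by
    intro U V h
    refine Polynomial.eq_of_infinite_eval_eq U V ?_
    exact infinite_of_mem_nhds (0 : ℂ) h
  have hP : P = 0 := by
    by_contra hP0
    -- Completing the square: multiplying κD + ez + t by P and eliminating PD = -R makes P² times
    -- the discriminant the square of a polynomial. Hence the discriminant itself is a square K².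
    have hsq : (P * (C e * X + C t) - C κ * R) ^ 2 =
        P ^ 2 * ((C e * X + C t) ^ 2 + C (κ * m) * X ^ 2) := by
      apply inf
      filter_upwards [hD, hPR] with z h1 h2
      simp only [eval_pow, eval_sub, eval_mul, eval_add, eval_C, eval_X]
      have : R.eval z = -(P.eval z * D z) := by linear_combination h2
      rw [this]
      linear_combination (P.eval z) ^ 2 * κ * h1
    obtain ⟨K, hK⟩ : P ∣ P * (C e * X + C t) - C κ * R := by
      rw [← IsIntegrallyClosed.pow_dvd_pow_iff (two_ne_zero), hsq]
      exact dvd_mul_right _ _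
    have hK2 : K ^ 2 = (C e * X + C t) ^ 2 + C (κ * m) * X ^ 2 := by
      rw [hK, mul_pow] at hsq
      exact mul_left_cancel₀ (pow_ne_zero 2 hP0) hsq
    have hdeg : K.natDegree ≤ 1 := by
      have h1 : (K ^ 2).natDegree ≤ 2 := by
        rw [hK2]
        compute_degree
      rw [natDegree_pow] at h1
      omega
    rw [Polynomial.eq_X_add_C_of_natDegree_le_one hdeg] at hK2
    set a := K.coeff 1
    set b := K.coeff 0
    have ev : ∀ z : ℂ, (a * z + b) ^ 2 = (e * z + t) ^ 2 + κ * m * z ^ 2 := by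
      intro z
      simpa using congrArg (Polynomial.eval z) hK2
    have h0 := ev 0
    have h1 := ev 1
    have h2 := ev (-1)
    have hb : b ^ 2 = t ^ 2 := by linear_combination h0
    have hab : a * b = e * t := by linear_combination (h1 - h2) / 4
    have haa : a ^ 2 = e ^ 2 + κ * m := by linear_combination (h1 + h2) / 2 - h0
    -- Compute (ab)² in two ways: it equals e²t², and also (e² + κm)t².
    have : κ * m * t ^ 2 = 0 := by
      linear_combination (a * b + e * t) * hab - a ^ 2 * hb - t ^ 2 * haa
    simp [hκ, hm, ht] at this
  refine ⟨hP, inf ?_⟩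
  filter_upwards [hPR] with z h
  simpa [hP] using h

/-- The arithmetic of the divisibility of the cubic relation by the quadratic one. -/
theorem weights_eq_one {x y p q e m t n₁ n₀ : ℂ} (hx1 : x + 1 ≠ 0)
    (hy1 : y + 1 ≠ 0) (ht : t ≠ 0) (hpq : p + q = 1)
    (he : e = p * x - q * y) (hme : m = 1 - p ^ 2 * x - q ^ 2 * y) (hm : m ≠ 0)
    (hn₁ : 3 * x ^ 2 * p + 3 * y ^ 2 * q - 2 * (x - y) * e - (x + y) * n₁ = 0)
    (hn₀ : 3 * t * (q * x - p * y) - 2 * (x - y) * t - (x + y) * n₀ = 0)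
    (hr₃ : x ^ 2 * p ^ 3 + y ^ 2 * q ^ 3 - 1 + m * n₁ = 0)
    (hr₂ : 3 * t * (q * x * p ^ 2 - p * y * q ^ 2) + m * n₀ = 0)
    (hP₂ : 3 * x ^ 2 * p ^ 2 - 3 * y ^ 2 * q ^ 2 + (x - y) * m - 2 * e * n₁ = 0)
    (hP₁ : 6 * t * p * q * (x + y) - 2 * (t * n₁ + e * n₀) = 0) : x = 1 ∧ y = 1 := by
  subst he hme
  obtain rfl : p = 1 - q := by linear_combination hpq
  -- In the variables A, B, with z = A + B and D = qA - pB, the quotient of the cubic by the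
  -- quadratic is gA + hB + n₀. The identities `c30` to `c02` compare coefficients of AⁱBʲ, where
  -- the products of the quotient and the quadratic are much simpler.
  obtain ⟨g, hg⟩ : ∃ g, g = (x - y) * q + n₁ := ⟨_, rfl⟩
  obtain ⟨h, hh⟩ : ∃ h, h = n₁ - (x - y) * (1 - q) := ⟨_, rfl⟩
  have c30 : x ^ 2 - 1 = g * (x - 1) := by
    rw [hg]
    linear_combination (exp := 1) hr₃ + q * hP₂ + q ^ 2 * hn₁
  have c21 : -3 = h * (x - 1) - 2 * g := by
    rw [hg, hh]
    linear_combination (exp := 1) 3 * hr₃ + (2 * q - (1 - q)) * hP₂ +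
      (q ^ 2 - 2 * (1 - q) * q) * hn₁
  have c12 : -3 = g * (y - 1) - 2 * h := by
    rw [hg, hh]
    linear_combination (exp := 1) 3 * hr₃ + (q - 2 * (1 - q)) * hP₂ +
      ((1 - q) ^ 2 - 2 * (1 - q) * q) * hn₁
  have c03 : y ^ 2 - 1 = h * (y - 1) := by
    rw [hh]
    linear_combination (exp := 1) hr₃ - (1 - q) * hP₂ + (1 - q) ^ 2 * hn₁
  have c20 : 3 * t * q * x - n₀ * (x - 1) - 2 * t * q * g = 0 := by
    rw [hg]
    linear_combination (exp := 1) hr₂ + q * hP₁ + q ^ 2 * hn₀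
  have c11 : 2 * n₀ - 2 * t * (q * h - (1 - q) * g) = 0 := by
    rw [hg, hh]
    linear_combination (exp := 1) 2 * hr₂ + (q - (1 - q)) * hP₁ - 2 * (1 - q) * q * hn₀
  have c02 : -3 * t * (1 - q) * y - n₀ * (y - 1) + 2 * t * (1 - q) * h = 0 := by
    rw [hh]
    linear_combination (exp := 1) hr₂ - (1 - q) * hP₁ + (1 - q) ^ 2 * hn₀
  by_cases hx : x = 1
  · refine ⟨hx, ?_⟩
    by_contra hy
    have hy' : y - 1 ≠ 0 := sub_ne_zero.2 hy
    have h1 : h = y + 1 := mul_right_cancel₀ hy' (by linear_combination -c03)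
    subst h1
    apply hy1
    subst hx
    linear_combination 2 * c12 + (y - 1) * c21
  · exfalso
    have hx' : x - 1 ≠ 0 := sub_ne_zero.2 hx
    have g1 : g = x + 1 := mul_right_cancel₀ hx' (by linear_combination -c30)
    subst g1
    by_cases hy : y = 1
    · subst hy
      apply hx1
      linear_combination 2 * c21 + (x - 1) * c12
    · have hy' : y - 1 ≠ 0 := sub_ne_zero.2 hy
      have h1 : h = y + 1 := mul_right_cancel₀ hy' (by linear_combination -c03)
      subst h1
      have hn : n₀ = t * (q * (y + 1) - (1 - q) * (x + 1)) := by linear_combination c11 / 2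
      have hxy : x * y = x + y := by linear_combination -c21
      subst hn
      have k1 : (1 - q) * x = 1 := by
        refine mul_left_cancel₀ (mul_ne_zero ht hx1) ?_
        linear_combination c20 + q * t * hxy
      have k2 : q * y = 1 := by
        refine mul_left_cancel₀ (mul_ne_zero ht hy1) ?_
        linear_combination -c02 + (1 - q) * t * hxy
      -- Here px = qy = 1, so m = 1 - p - q = 0. This is the diagonal solution, excluded by m ≠ 0.
      apply hm
      linear_combination -(1 - q) * k1 - q * k2

/-! ### Taylor coefficients at the origin and the normal form -/

theorem IsCenteredIsometry.symm {l₁ l₂ : ℝ} {f g : ℂ → ℂ} (h : IsCenteredIsometry l₁ l₂ f g) :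
    IsCenteredIsometry l₂ l₁ g f :=
  ⟨⟨h.diff₂, h.diff₁, h.mapsTo₂, h.mapsTo₁, fun z hz => by
    rw [add_comm]; exact h.metric z hz⟩, h.zero₂, h.zero₁⟩

theorem eventually_mem_half : ∀ᶠ z in 𝓝 (0 : ℂ), z ∈ ball (0 : ℂ) (1 / 2) :=
  ball_mem_nhds _ (by norm_num)

/-- The relations between Taylor coefficients at the origin obtained by differentiating
`IsCenteredIsometry.expansion`. -/
theorem IsCenteredIsometry.moments {l₁ l₂ : ℝ} {f g : ℂ → ℂ}
    (h : IsCenteredIsometry l₁ l₂ f g) :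
    l₁ * (conj (deriv f 0) * deriv f 0) + l₂ * (conj (deriv g 0) * deriv g 0) = 1 ∧
    l₁ * (conj (deriv (deriv f) 0) * deriv f 0) +
      l₂ * (conj (deriv (deriv g) 0) * deriv g 0) = 0 ∧
    l₁ * (conj (deriv (deriv f) 0) * deriv (deriv f) 0 +
        2 * (conj (deriv f 0) * deriv f 0) ^ 2) +
      l₂ * (conj (deriv (deriv g) 0) * deriv (deriv g) 0 +
        2 * (conj (deriv g 0) * deriv g 0) ^ 2) = 2 ∧
    l₁ * (conj (deriv (deriv (deriv f)) 0) * deriv f 0) +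
      l₂ * (conj (deriv (deriv (deriv g)) 0) * deriv g 0) = 0 := by
  have hf := h.diff₁.analyticAt (disk_mem_nhds zero_mem_disk)
  have hg := h.diff₂.analyticAt (disk_mem_nhds zero_mem_disk)
  have comb : ∀ a₁ a₂ a₃ b₁ b₂ b₃ : ℂ, ∀ᶠ z in 𝓝 0, HasDerivAt
      (fun z => l₁ * (a₁ * f z + a₂ * f z ^ 2 + a₃ * f z ^ 3) +
        l₂ * (b₁ * g z + b₂ * g z ^ 2 + b₃ * g z ^ 3))
      (l₁ * (a₁ * deriv f z + a₂ * (2 * f z * deriv f z) + a₃ * (3 * f z ^ 2 * deriv f z)) +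
        l₂ * (b₁ * deriv g z + b₂ * (2 * g z * deriv g z) + b₃ * (3 * g z ^ 2 * deriv g z)))
      z := by
    intro a₁ a₂ a₃ b₁ b₂ b₃
    filter_upwards [hf.eventually_analyticAt, hg.eventually_analyticAt] with z h1 h2
    have df := h1.differentiableAt.hasDerivAt
    have dg := h2.differentiableAt.hasDerivAt
    refine ((((df.const_mul a₁).add ((df.pow 2).const_mul a₂)).add
      ((df.pow 3).const_mul a₃)).const_mul (l₁ : ℂ) |>.add <|
      (((dg.const_mul b₁).add ((dg.pow 2).const_mul b₂)).add
      ((dg.pow 3).const_mul b₃)).const_mul (l₂ : ℂ)).congr_deriv ?_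
    push_cast
    ring
  have first : ∀ (a₁ a₂ a₃ b₁ b₂ b₃ : ℂ) (ψ ψ' : ℂ → ℂ), (∀ z, HasDerivAt ψ (ψ' z) z) →
      (∀ z ∈ ball (0 : ℂ) (1 / 2), l₁ * (a₁ * f z + a₂ * f z ^ 2 + a₃ * f z ^ 3) +
        l₂ * (b₁ * g z + b₂ * g z ^ 2 + b₃ * g z ^ 3) = ψ z) → ∀ᶠ z in 𝓝 0,
      l₁ * (a₁ * deriv f z + a₂ * (2 * f z * deriv f z) + a₃ * (3 * f z ^ 2 * deriv f z)) +
        l₂ * (b₁ * deriv g z + b₂ * (2 * g z * deriv g z) + b₃ * (3 * g z ^ 2 * deriv g z)) =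
      ψ' z := by
    intro a₁ a₂ a₃ b₁ b₂ b₃ ψ ψ' hψ heq
    filter_upwards [comb a₁ a₂ a₃ b₁ b₂ b₃, eventually_mem_half] with z h1 h2
    exact h1.unique ((hψ z).congr_of_eventuallyEq
      (eventually_of_mem (isOpen_ball.mem_nhds h2) heq))
  have k1 := (first (conj (deriv f 0)) 0 0 (conj (deriv g 0)) 0 0 (fun z => z) (fun _ => 1)
    hasDerivAt_id (fun z hz => by linear_combination (h.expansion hz).1)).self_of_nhds
  have k2 := first (conj (deriv (deriv f) 0)) (conj (deriv f 0) ^ 2) 0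
    (conj (deriv (deriv g) 0)) (conj (deriv g 0) ^ 2) 0 (fun z => z ^ 2) (fun z => 2 * z)
    (fun z => by simpa using hasDerivAt_pow 2 z)
    (fun z hz => by linear_combination (h.expansion hz).2.1)
  have k3 := (first (conj (deriv (deriv (deriv f)) 0))
    (3 * conj (deriv f 0) * conj (deriv (deriv f) 0)) (2 * conj (deriv f 0) ^ 3)
    (conj (deriv (deriv (deriv g)) 0))
    (3 * conj (deriv g 0) * conj (deriv (deriv g) 0)) (2 * conj (deriv g 0) ^ 3)
    (fun z => 2 * z ^ 3) (fun z => 2 * (3 * z ^ 2))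
    (fun z => by simpa using (hasDerivAt_pow 3 z).const_mul 2)
    (fun z hz => by linear_combination (h.expansion hz).2.2)).self_of_nhds
  have k2' := k2.self_of_nhds
  have df := hf.differentiableAt.hasDerivAt
  have dg := hg.differentiableAt.hasDerivAt
  have df2 := hf.deriv.differentiableAt.hasDerivAt
  have dg2 := hg.deriv.differentiableAt.hasDerivAt
  -- First derivatives at 0 see only the terms linear in f and g. The moment containing |f''(0)|²
  -- and |g''(0)|² needs a second derivative of the quadratic relation.
  have d2 := (((df2.const_mul (conj (deriv (deriv f) 0))).add
    ((df.mul df2).const_mul (2 * conj (deriv f 0) ^ 2))).const_mul (l₁ : ℂ)).add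
    (((dg2.const_mul (conj (deriv (deriv g) 0))).add
    ((dg.mul dg2).const_mul (2 * conj (deriv g 0) ^ 2))).const_mul (l₂ : ℂ))
  have k4 := d2.unique (((hasDerivAt_id (0 : ℂ)).const_mul 2).congr_of_eventuallyEq (by
    filter_upwards [k2] with z hz
    simp only [Pi.add_apply, Pi.mul_apply, id]
    linear_combination hz))
  simp only [h.zero₁, h.zero₂] at k1 k2' k3 k4
  refine ⟨?_, ?_, ?_, ?_⟩
  · linear_combination k1
  · linear_combination k2'
  · linear_combination k4
  · linear_combination k3

theorem conj_mul_eq_normSq (z : ℂ) : conj z * z = ((‖z‖ ^ 2 : ℝ) : ℂ) := by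
  rw [mul_comm, mul_conj, normSq_eq_norm_sq]

/-- The quadratic and cubic relations satisfied by `A = l₁ conj (f' 0) f`. -/
theorem IsCenteredIsometry.normal_form {l₁ l₂ p q : ℝ} {f g : ℂ → ℂ} (hl₁ : 0 < l₁) (hl₂ : 0 < l₂)
    (h : IsCenteredIsometry l₁ l₂ f g) (hf : deriv f 0 ≠ 0) (hg : deriv g 0 ≠ 0)
    (hp : p = l₁ * ‖deriv f 0‖ ^ 2) (hq : q = l₂ * ‖deriv g 0‖ ^ 2) :
    ∃ t s : ℂ, p + q = 1 ∧ 1 - p ^ 2 / l₁ - q ^ 2 / l₂ = 2 * p * q * ‖t‖ ^ 2 ∧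
      conj (deriv (deriv f) 0) = 2 * q * t * conj (deriv f 0) ∧
      ∀ z ∈ ball (0 : ℂ) (1 / 2), ∀ A B : ℂ, A = l₁ * conj (deriv f 0) * f z →
        B = l₂ * conj (deriv g 0) * g z →
        A + B = z ∧ A ^ 2 / l₁ + B ^ 2 / l₂ + 2 * t * (q * A - p * B) = z ^ 2 ∧
        A ^ 3 / l₁ ^ 2 + B ^ 3 / l₂ ^ 2 + 3 * t * (q * A ^ 2 / l₁ - p * B ^ 2 / l₂) +
          3 * s * (q * A - p * B) = z ^ 3 := by
  have hf' : conj (deriv f 0) ≠ 0 := by simpa using hf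
  have hg' : conj (deriv g 0) ≠ 0 := by simpa using hg
  have hp0 : 0 < p := by rw [hp]; positivity
  have hq0 : 0 < q := by rw [hq]; positivity
  have hp0' : (p : ℂ) ≠ 0 := by exact_mod_cast hp0.ne'
  have hq0' : (q : ℂ) ≠ 0 := by exact_mod_cast hq0.ne'
  have hl₁' : (l₁ : ℂ) ≠ 0 := by exact_mod_cast hl₁.ne'
  have hl₂' : (l₂ : ℂ) ≠ 0 := by exact_mod_cast hl₂.ne'
  obtain ⟨m1, m2, m3, m4⟩ := h.moments
  have hpc : (l₁ : ℂ) * (conj (deriv f 0) * deriv f 0) = p := by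
    rw [conj_mul_eq_normSq, hp]; push_cast; ring
  have hqc : (l₂ : ℂ) * (conj (deriv g 0) * deriv g 0) = q := by
    rw [conj_mul_eq_normSq, hq]; push_cast; ring
  have hpq : p + q = 1 := by
    rw [hpc, hqc] at m1
    exact_mod_cast m1
  -- The orthogonality moments `m2` and `m4` tie g''(0) to f''(0) and g'''(0) to f'''(0). A single
  -- parameter thus encodes both second derivatives, and another one both third derivatives.
  obtain ⟨t, ht⟩ : ∃ t, conj (deriv (deriv f) 0) = 2 * q * t * conj (deriv f 0) :=
    ⟨conj (deriv (deriv f) 0) / (2 * q * conj (deriv f 0)), by field_simp⟩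
  obtain ⟨s, hs⟩ : ∃ s, conj (deriv (deriv (deriv f)) 0) = 6 * q * s * conj (deriv f 0) :=
    ⟨conj (deriv (deriv (deriv f)) 0) / (6 * q * conj (deriv f 0)), by field_simp⟩
  have ht' : conj (deriv (deriv g) 0) = -2 * p * t * conj (deriv g 0) := by
    rw [ht] at m2
    refine mul_left_cancel₀ hq0' ?_
    linear_combination conj (deriv g 0) * m2 - conj (deriv (deriv g) 0) * hqc -
      2 * q * t * conj (deriv g 0) * hpc
  have hs' : conj (deriv (deriv (deriv g)) 0) = -6 * p * s * conj (deriv g 0) := by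
    rw [hs] at m4
    refine mul_left_cancel₀ hq0' ?_
    linear_combination conj (deriv g 0) * m4 - conj (deriv (deriv (deriv g)) 0) * hqc -
      6 * q * s * conj (deriv g 0) * hpc
  refine ⟨t, s, hpq, ?_, ht, ?_⟩
  · have n1 : ‖deriv (deriv f) 0‖ ^ 2 = 4 * q ^ 2 * ‖t‖ ^ 2 * ‖deriv f 0‖ ^ 2 := by
      have := congrArg (fun w => ‖w‖ ^ 2) ht
      simp only [norm_mul, RCLike.norm_conj, norm_real, Real.norm_of_nonneg hq0.le,
        Complex.norm_ofNat] at this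
      rw [this]; ring
    have n2 : ‖deriv (deriv g) 0‖ ^ 2 = 4 * p ^ 2 * ‖t‖ ^ 2 * ‖deriv g 0‖ ^ 2 := by
      have := congrArg (fun w => ‖w‖ ^ 2) ht'
      simp only [norm_mul, norm_neg, RCLike.norm_conj, norm_real, Real.norm_of_nonneg hp0.le,
        Complex.norm_ofNat] at this
      rw [this]; ring
    simp only [conj_mul_eq_normSq] at m3
    have m3' : l₁ * (‖deriv (deriv f) 0‖ ^ 2 + 2 * (‖deriv f 0‖ ^ 2) ^ 2) +
      l₂ * (‖deriv (deriv g) 0‖ ^ 2 + 2 * (‖deriv g 0‖ ^ 2) ^ 2) = 2 := by exact_mod_cast m3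
    rw [n1, n2] at m3'
    have e1 : ‖deriv f 0‖ ^ 2 = p / l₁ := by rw [hp]; field_simp
    have e2 : ‖deriv g 0‖ ^ 2 = q / l₂ := by rw [hq]; field_simp
    rw [e1, e2] at m3'
    field_simp at m3' ⊢
    linear_combination -m3' / 2 + 2 * l₁ * l₂ * p * q * ‖t‖ ^ 2 * hpq
  · rintro z hz A B hA hB
    obtain ⟨x1, x2, x3⟩ := h.expansion hz
    refine ⟨?_, ?_, ?_⟩
    · rw [hA, hB]; linear_combination x1
    · rw [ht, ht'] at x2
      rw [hA, hB, ← x2]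
      field_simp
      ring
    · rw [ht, ht', hs, hs'] at x3
      rw [hA, hB]
      field_simp
      linear_combination x3 / 2

/-! ### Degenerate cases: a vanishing first or second derivative -/

theorem eqOn_disk_of_eventuallyEq {f g : ℂ → ℂ} (hf : DifferentiableOn ℂ f disk)
    (hg : DifferentiableOn ℂ g disk) (h : f =ᶠ[𝓝 0] g) : Set.EqOn f g disk :=
  (hf.analyticOnNhd isOpen_disk).eqOn_of_preconnected_of_eventuallyEq
    (hg.analyticOnNhd isOpen_disk) (convex_ball _ _).isPreconnected zero_mem_disk h

/-- If the first component is critical at the origin, then it vanishes identically and the second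
component is a rotation. -/
theorem IsCenteredIsometry.of_deriv_eq_zero {l₁ l₂ : ℝ} {f g : ℂ → ℂ} (hl₁ : 0 < l₁) (hl₂ : 0 < l₂)
    (h : IsCenteredIsometry l₁ l₂ f g) (hf : deriv f 0 = 0) :
    l₂ = 1 ∧ Set.EqOn f 0 disk ∧ ∃ c : ℂ, ‖c‖ = 1 ∧ Set.EqOn g (fun z => c * z) disk := by
  have hl₁' : (l₁ : ℂ) ≠ 0 := by exact_mod_cast hl₁.ne'
  obtain ⟨m1, -, -, -⟩ := h.moments
  rw [conj_mul_eq_normSq, conj_mul_eq_normSq, hf, norm_zero] at m1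
  set b := deriv g 0 with hb
  have hn : l₂ * ‖b‖ ^ 2 = 1 := by
    have : l₁ * 0 ^ 2 + l₂ * ‖b‖ ^ 2 = 1 := by exact_mod_cast m1
    linarith
  have hbb := conj_mul_eq_normSq b
  set n := ‖b‖ ^ 2 with hn_def
  have hnc : (l₂ : ℂ) * (n : ℂ) = 1 := by exact_mod_cast hn
  have hgz : ∀ z ∈ ball (0 : ℂ) (1 / 2), g z = b * z := by
    intro z hz
    have x1 := (h.expansion hz).1
    rw [hf, map_zero, ← hb] at x1
    linear_combination b * x1 - g z * hnc - l₂ * g z * hbb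
  have hgev : g =ᶠ[𝓝 0] fun z => b * z := by
    filter_upwards [eventually_mem_half] with z hz using hgz z hz
  have hg1 : deriv g =ᶠ[𝓝 0] fun _ => b := by
    filter_upwards [hgev.deriv] with z hz
    rw [hz]; simp
  have hg2 : deriv (deriv g) =ᶠ[𝓝 0] fun _ => 0 := by
    filter_upwards [hg1.deriv] with z hz
    rw [hz]; simp
  have hg3 : deriv (deriv (deriv g)) =ᶠ[𝓝 0] fun _ => 0 := by
    filter_upwards [hg2.deriv] with z hz
    rw [hz]; simp
  have q2 : ∀ z ∈ ball (0 : ℂ) (1 / 2),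
      l₁ * conj (deriv (deriv f) 0) * f z = (1 - l₂ * n ^ 2) * z ^ 2 := by
    intro z hz
    have x2 := (h.expansion hz).2.1
    rw [hf, map_zero, ← hb, hg2.self_of_nhds, map_zero, hgz z hz] at x2
    linear_combination x2 - l₂ * z ^ 2 * (conj b * b + n) * hbb
  have q3 : ∀ z ∈ ball (0 : ℂ) (1 / 2),
      l₁ * conj (deriv (deriv (deriv f)) 0) * f z = 2 * (1 - l₂ * n ^ 3) * z ^ 3 := by
    intro z hz
    have x3 := (h.expansion hz).2.2
    rw [hf, map_zero, ← hb, hg2.self_of_nhds, hg3.self_of_nhds, map_zero, hgz z hz] at x3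
    linear_combination x3 - 2 * l₂ * z ^ 3 * ((conj b * b) ^ 2 + conj b * b * n + n ^ 2) * hbb
  have hn0 : 0 < n := by
    by_contra hc
    nlinarith
  have hn1 : n = 1 := by
    by_cases hA : conj (deriv (deriv f) 0) = 0
    · have := q2 (1 / 4) (by norm_num [mem_ball_zero_iff])
      rw [hA] at this
      have h2 : l₂ * n ^ 2 = 1 := by
        have : (l₂ : ℂ) * n ^ 2 = 1 := by linear_combination 16 * this
        exact_mod_cast this
      nlinarith
    · have hp : (1 / 4 : ℂ) ∈ ball (0 : ℂ) (1 / 2) := by norm_num [mem_ball_zero_iff]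
      have hm : (-1 / 4 : ℂ) ∈ ball (0 : ℂ) (1 / 2) := by norm_num [mem_ball_zero_iff]
      -- The quadratic relation makes a multiple of f even and the cubic one makes a multiple of f
      -- odd. Comparing the values at 1/4 and -1/4 separates the two.
      have : conj (deriv (deriv f) 0) * (1 - l₂ * n ^ 3) = 0 := by
        linear_combination 16 * (conj (deriv (deriv (deriv f)) 0) * (q2 _ hp - q2 _ hm) -
          conj (deriv (deriv f) 0) * (q3 _ hp - q3 _ hm))
      have h3 : (l₂ : ℂ) * n ^ 3 = 1 := by
        linear_combination -(mul_eq_zero.1 this).resolve_left hA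
      have h3' : l₂ * n ^ 3 = 1 := by exact_mod_cast h3
      have : n ^ 2 = 1 := by linear_combination h3' - n ^ 2 * hn
      nlinarith
  have hl2 : l₂ = 1 := by rw [hn1] at hn; linarith
  have hb1 : ‖b‖ = 1 := by
    have : ‖b‖ ^ 2 = 1 := hn1
    nlinarith [norm_nonneg b]
  have hgd : Set.EqOn g (fun z => b * z) disk :=
    eqOn_disk_of_eventuallyEq h.diff₂ (by fun_prop) hgev
  refine ⟨hl2, ?_, b, hb1, hgd⟩
  -- The rotation g with weight 1 already accounts for the whole metric, so nothing is left for f'.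
  have hf' : ∀ z ∈ disk, deriv f z = 0 := by
    intro z hz
    have hm := h.metric z hz
    have hd : deriv g z = b := by
      rw [(hgd.eventuallyEq_of_mem (disk_mem_nhds hz)).deriv_eq]; simp
    rw [hgd hz, hd, norm_mul, hb1, hl2] at hm
    have hpos := one_sub_normSq_pos (h.mapsTo₁ hz)
    have : l₁ * ‖deriv f z‖ ^ 2 / (1 - ‖f z‖ ^ 2) ^ 2 = 0 := by
      simpa using hm
    have h2 : l₁ * ‖deriv f z‖ ^ 2 = 0 := by
      rcases div_eq_zero_iff.1 this with h | h
      · exact h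
      · exact absurd h (by positivity)
    simpa [hl₁.ne'] using h2
  intro z hz
  rw [isOpen_disk.is_const_of_deriv_eq_zero (convex_ball _ _).isPreconnected h.diff₁ hf' hz
    zero_mem_disk, h.zero₁]
  rfl

/-- Where the second factor vanishes, D = -2ez/κ; since D = o(z), near the origin this is possible
only at z = 0, unless e = 0, when the second factor is a multiple of D. -/
theorem eq_zero_of_mul_eq_zero_of_hasDerivAt {D : ℂ → ℂ} (h0 : D 0 = 0) (hD : HasDerivAt D 0 0)
    {κ e : ℂ} (hκ : κ ≠ 0) (h : ∀ᶠ z in 𝓝 0, D z * (κ * D z + 2 * e * z) = 0) :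
    ∀ᶠ z in 𝓝 0, D z = 0 := by
  by_cases he : e = 0
  · filter_upwards [h] with z hz
    simpa [he, hκ] using hz
  · have ho := hD.isLittleO
    have hc : 0 < ‖e‖ / ‖κ‖ := by positivity
    filter_upwards [h, ho.def hc] with z hz hb
    simp only [h0, sub_zero, smul_zero] at hb
    rcases mul_eq_zero.1 hz with h1 | h1
    · exact h1
    · have h2 : κ * D z = -(2 * e * z) := by linear_combination h1
      have h3 := congrArg norm h2
      simp only [norm_mul, norm_neg, Complex.norm_ofNat] at h3
      rw [div_mul_eq_mul_div, le_div_iff₀ (by positivity)] at hb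
      have : ‖e‖ * ‖z‖ = 0 := le_antisymm (by linarith) (by positivity)
      have hz0 : z = 0 := by simpa [he] using this
      rw [hz0, h0]

/-- Both components are rotations if both are regular at the origin and the first one has
vanishing second derivative there. -/
theorem IsCenteredIsometry.of_deriv_deriv_eq_zero {l₁ l₂ : ℝ} {f g : ℂ → ℂ} (hl₁ : 0 < l₁)
    (hl₂ : 0 < l₂) (h : IsCenteredIsometry l₁ l₂ f g) (hf : deriv f 0 ≠ 0) (hg : deriv g 0 ≠ 0)
    (hf2 : deriv (deriv f) 0 = 0) :
    l₁ + l₂ = 1 ∧ ∃ a b : ℂ, ‖a‖ = 1 ∧ ‖b‖ = 1 ∧ Set.EqOn f (fun z => a * z) disk ∧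
      Set.EqOn g (fun z => b * z) disk := by
  obtain ⟨p, hp⟩ : ∃ p, p = l₁ * ‖deriv f 0‖ ^ 2 := ⟨_, rfl⟩
  obtain ⟨q, hq⟩ : ∃ q, q = l₂ * ‖deriv g 0‖ ^ 2 := ⟨_, rfl⟩
  have hp0 : 0 < p := by rw [hp]; positivity
  have hq0 : 0 < q := by rw [hq]; positivity
  have hl₁' : (l₁ : ℂ) ≠ 0 := by exact_mod_cast hl₁.ne'
  have hl₂' : (l₂ : ℂ) ≠ 0 := by exact_mod_cast hl₂.ne'
  obtain ⟨t, s, hpq, hm, ht, hrel⟩ := h.normal_form hl₁ hl₂ hf hg hp hq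
  have hq0' : (q : ℂ) ≠ 0 := by exact_mod_cast hq0.ne'
  obtain rfl : t = 0 := by
    rw [hf2, map_zero] at ht
    have hf' : conj (deriv f 0) ≠ 0 := by simpa using hf
    have := ht.symm
    simp only [mul_eq_zero, hq0', hf', OfNat.ofNat_ne_zero, false_or, or_false] at this
    exact this
  have hpc : (l₁ : ℂ) * (conj (deriv f 0) * deriv f 0) = p := by
    rw [conj_mul_eq_normSq, hp]; push_cast; ring
  have hqc : (l₂ : ℂ) * (conj (deriv g 0) * deriv g 0) = q := by
    rw [conj_mul_eq_normSq, hq]; push_cast; ring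
  have hpqc : (p : ℂ) + q = 1 := by exact_mod_cast hpq
  have hm0 : 1 - p ^ 2 / l₁ - q ^ 2 / l₂ = 0 := by rw [hm]; simp
  have hmc : (1 : ℂ) - p ^ 2 / l₁ - q ^ 2 / l₂ = 0 := by exact_mod_cast hm0
  -- D is the deviation of the normalized first component A from its linear part pz. With t = 0 and
  -- 1 - p²/l₁ - q²/l₂ = 0, the quadratic relation factors as D(κD + 2ez) = 0.
  have hD : ∀ᶠ z in 𝓝 0, l₁ * conj (deriv f 0) * f z - p * z = 0 := by
    refine eq_zero_of_mul_eq_zero_of_hasDerivAt (κ := 1 / l₁ + 1 / l₂) (e := p / l₁ - q / l₂)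
      (D := fun z => l₁ * conj (deriv f 0) * f z - p * z)
      (by simp [h.zero₁]) ?_ ?_ ?_
    · have df := (h.diff₁.differentiableAt (disk_mem_nhds zero_mem_disk)).hasDerivAt
      refine ((df.const_mul (l₁ * conj (deriv f 0))).sub
        ((hasDerivAt_id (0 : ℂ)).const_mul (p : ℂ))).congr_deriv ?_
      linear_combination hpc
    · have : 1 / l₁ + 1 / l₂ ≠ 0 := by positivity
      exact_mod_cast this
    · filter_upwards [eventually_mem_half] with z hz
      obtain ⟨r1, r2, -⟩ := hrel z hz _ _ rfl rfl
      set A := l₁ * conj (deriv f 0) * f z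
      obtain hB := eq_sub_of_add_eq' r1
      rw [hB] at r2
      have hqp : (q : ℂ) = 1 - p := by linear_combination hpqc
      rw [hqp] at r2 hmc ⊢
      linear_combination r2 + z ^ 2 * hmc
  have hfd : Set.EqOn f (fun z => deriv f 0 * z) disk := by
    refine eqOn_disk_of_eventuallyEq h.diff₁ (by fun_prop) ?_
    filter_upwards [hD] with z hz
    have hf' : l₁ * conj (deriv f 0) ≠ 0 := mul_ne_zero hl₁' (by simpa using hf)
    refine mul_left_cancel₀ hf' ?_
    linear_combination hz - z * hpc
  have hgd : Set.EqOn g (fun z => deriv g 0 * z) disk := by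
    refine eqOn_disk_of_eventuallyEq h.diff₂ (by fun_prop) ?_
    filter_upwards [hD, eventually_mem_half] with z hz hz'
    have hg' : l₂ * conj (deriv g 0) ≠ 0 := mul_ne_zero hl₂' (by simpa using hg)
    refine mul_left_cancel₀ hg' ?_
    linear_combination (hrel z hz' _ _ rfl rfl).1 - hz - z * hqc - z * hpqc
  have hq4 : (1 / 4 : ℂ) ∈ ball (0 : ℂ) (1 / 2) := by norm_num [mem_ball_zero_iff]
  have hcub : (p : ℂ) ^ 3 / l₁ ^ 2 + q ^ 3 / l₂ ^ 2 = 1 := by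
    have r3 := (hrel (1 / 4) hq4 (p * (1 / 4)) (q * (1 / 4))
      (by rw [hfd (half_subset_disk hq4)]; linear_combination -(1 / 4) * hpc)
      (by rw [hgd (half_subset_disk hq4)]; linear_combination -(1 / 4) * hqc)).2.2
    linear_combination 64 * r3
  have hcub' : p ^ 3 / l₁ ^ 2 + q ^ 3 / l₂ ^ 2 = 1 := by exact_mod_cast hcub
  -- A vanishing variance: with weights p and q, the numbers p/l₁ and q/l₂ have first and second
  -- moments both equal to 1, so both numbers are 1.
  have hsum : p * (p / l₁ - 1) ^ 2 + q * (q / l₂ - 1) ^ 2 = 0 := by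
    linear_combination hcub' + 2 * hm0 + hpq
  have hu : p / l₁ = 1 := by
    have : p * (p / l₁ - 1) ^ 2 = 0 :=
      le_antisymm (by nlinarith [mul_nonneg hq0.le (sq_nonneg (q / l₂ - 1))]) (by positivity)
    have := pow_eq_zero_iff two_ne_zero |>.1 ((mul_eq_zero.1 this).resolve_left hp0.ne')
    linarith
  have hv : q / l₂ = 1 := by
    have : q * (q / l₂ - 1) ^ 2 = 0 :=
      le_antisymm (by nlinarith [mul_nonneg hp0.le (sq_nonneg (p / l₁ - 1))]) (by positivity)
    have := pow_eq_zero_iff two_ne_zero |>.1 ((mul_eq_zero.1 this).resolve_left hq0.ne')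
    linarith
  have hna : ‖deriv f 0‖ = 1 := by
    have : ‖deriv f 0‖ ^ 2 = 1 := by rw [← hu, hp]; field_simp
    nlinarith [norm_nonneg (deriv f 0)]
  have hnb : ‖deriv g 0‖ = 1 := by
    have : ‖deriv g 0‖ ^ 2 = 1 := by rw [← hv, hq]; field_simp
    nlinarith [norm_nonneg (deriv g 0)]
  refine ⟨?_, _, _, hna, hnb, hfd, hgd⟩
  rw [hna] at hp
  rw [hnb] at hq
  linarith

/-! ### The weights in the nondegenerate case -/

/-- A centered isometry with regular components and nonvanishing second derivative at the origin
has both weights equal to one. -/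
theorem IsCenteredIsometry.weights_eq_one {l₁ l₂ : ℝ} {f g : ℂ → ℂ} (hl₁ : 0 < l₁)
    (hl₂ : 0 < l₂) (h : IsCenteredIsometry l₁ l₂ f g) (hf : deriv f 0 ≠ 0) (hg : deriv g 0 ≠ 0)
    (hf2 : deriv (deriv f) 0 ≠ 0) : l₁ = 1 ∧ l₂ = 1 := by
  obtain ⟨p, hp⟩ : ∃ p, p = l₁ * ‖deriv f 0‖ ^ 2 := ⟨_, rfl⟩
  obtain ⟨q, hq⟩ : ∃ q, q = l₂ * ‖deriv g 0‖ ^ 2 := ⟨_, rfl⟩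
  have hp0 : 0 < p := by rw [hp]; positivity
  have hq0 : 0 < q := by rw [hq]; positivity
  have hl₁' : (l₁ : ℂ) ≠ 0 := by exact_mod_cast hl₁.ne'
  have hl₂' : (l₂ : ℂ) ≠ 0 := by exact_mod_cast hl₂.ne'
  obtain ⟨t, s, hpq, hm, ht, hrel⟩ := h.normal_form hl₁ hl₂ hf hg hp hq
  have ht0 : t ≠ 0 := by
    rintro rfl
    apply hf2
    simpa using ht
  have hm0 : 1 - p ^ 2 / l₁ - q ^ 2 / l₂ ≠ 0 := by rw [hm]; positivity
  obtain ⟨x, hx⟩ : ∃ x : ℝ, x = 1 / l₁ := ⟨_, rfl⟩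
  obtain ⟨y, hy⟩ : ∃ y : ℝ, y = 1 / l₂ := ⟨_, rfl⟩
  have hx0 : 0 < x := by rw [hx]; positivity
  have hy0 : 0 < y := by rw [hy]; positivity
  obtain ⟨e, he⟩ : ∃ e : ℂ, e = p * x - q * y := ⟨_, rfl⟩
  obtain ⟨m, hm⟩ : ∃ m : ℂ, m = 1 - p ^ 2 * x - q ^ 2 * y := ⟨_, rfl⟩
  have hm' : m ≠ 0 := by
    rw [hm, hx, hy]
    intro hc
    apply hm0
    have : (1 : ℝ) - p ^ 2 * (1 / l₁) - q ^ 2 * (1 / l₂) = 0 := by exact_mod_cast hc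
    rw [← this]; ring
  have hκ : (x : ℂ) + y ≠ 0 := by
    have : x + y ≠ 0 := by positivity
    exact_mod_cast this
  have hpqc : (p : ℂ) + q = 1 := by exact_mod_cast hpq
  -- Division of the cubic by the quadratic, as polynomials in D: the quotient is (x - y)D + n₁z +
  -- n₀, with `n₁` and `n₀` chosen to cancel the terms in D²z and D². The remainder, linear in D,
  -- has coefficients built from `P₂`, `P₁`, `r₃`, `r₂`.
  obtain ⟨n₁, hn₁⟩ : ∃ n₁ : ℂ,
      3 * x ^ 2 * p + 3 * y ^ 2 * q - 2 * (x - y) * e - (x + y) * n₁ = 0 :=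
    ⟨(3 * x ^ 2 * p + 3 * y ^ 2 * q - 2 * (x - y) * e) / (x + y), by field_simp; ring⟩
  obtain ⟨n₀, hn₀⟩ : ∃ n₀ : ℂ,
      3 * t * (q * x - p * y) - 2 * (x - y) * t - (x + y) * n₀ = 0 :=
    ⟨(3 * t * (q * x - p * y) - 2 * (x - y) * t) / (x + y), by field_simp; ring⟩
  obtain ⟨P₂, hP₂⟩ : ∃ P₂ : ℂ, P₂ = 3 * x ^ 2 * p ^ 2 - 3 * y ^ 2 * q ^ 2 + (x - y) * m -
    2 * e * n₁ := ⟨_, rfl⟩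
  obtain ⟨P₁, hP₁⟩ : ∃ P₁ : ℂ, P₁ = 6 * t * p * q * (x + y) - 2 * (t * n₁ + e * n₀) := ⟨_, rfl⟩
  obtain ⟨r₃, hr₃⟩ : ∃ r₃ : ℂ, r₃ = x ^ 2 * p ^ 3 + y ^ 2 * q ^ 3 - 1 + m * n₁ := ⟨_, rfl⟩
  obtain ⟨r₂, hr₂⟩ : ∃ r₂ : ℂ,
    r₂ = 3 * t * (q * x * p ^ 2 - p * y * q ^ 2) + m * n₀ := ⟨_, rfl⟩
  have rel : ∀ᶠ z in 𝓝 0, ∃ D, D = l₁ * conj (deriv f 0) * f z - p * z ∧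
      (x + y) * D ^ 2 + 2 * (e * z + t) * D - m * z ^ 2 = 0 ∧
      (P₂ * z ^ 2 + P₁ * z + (3 * s - 2 * t * n₀)) * D + (r₃ * z ^ 3 + r₂ * z ^ 2) = 0 := by
    filter_upwards [eventually_mem_half] with z hz
    refine ⟨_, rfl, ?_⟩
    obtain ⟨r1, r2, r3⟩ := hrel z hz _ _ rfl rfl
    have hB := eq_sub_of_add_eq' r1
    have hA : l₁ * conj (deriv f 0) * f z = p * z + (l₁ * conj (deriv f 0) * f z - p * z) := by
      ring
    set D := l₁ * conj (deriv f 0) * f z - p * z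
    rw [hB, hA] at r2 r3
    have hxc : (x : ℂ) = 1 / l₁ := by rw [hx]; push_cast; rfl
    have hyc : (y : ℂ) = 1 / l₂ := by rw [hy]; push_cast; rfl
    have hqp : (q : ℂ) = 1 - p := by linear_combination hpqc
    have quad : (x + y) * D ^ 2 + 2 * (e * z + t) * D - m * z ^ 2 = 0 := by
      rw [he, hm, hxc, hyc]
      rw [hqp] at r2 ⊢
      linear_combination r2
    refine ⟨quad, ?_⟩
    rw [hr₃, hr₂, hP₂, hP₁]
    have cub : x ^ 2 * (p * z + D) ^ 3 + y ^ 2 * (q * z - D) ^ 3 +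
        3 * t * (q * x * (p * z + D) ^ 2 - p * y * (q * z - D) ^ 2) + 3 * s * D - z ^ 3 = 0 := by
      rw [hxc, hyc]
      rw [hqp] at r3 ⊢
      linear_combination r3
    linear_combination cub - ((x - y) * D + n₁ * z + n₀) * quad - D ^ 2 * z * hn₁ - D ^ 2 * hn₀
  open Polynomial in
  obtain ⟨hP, hR⟩ := linear_relation_trivial (κ := x + y) (e := e) (t := t) (m := m) hκ ht0 hm'
    (D := fun z => l₁ * conj (deriv f 0) * f z - p * z)
    (P := C P₂ * X ^ 2 + C P₁ * X + C (3 * s - 2 * t * n₀)) (R := C r₃ * X ^ 3 + C r₂ * X ^ 2)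
    (by filter_upwards [rel] with z ⟨D, hD, h1, h2⟩; rw [← hD]; exact h1)
    (by filter_upwards [rel] with z ⟨D, hD, h1, h2⟩; rw [← hD]; simpa using h2)
  have evP : ∀ z : ℂ, P₂ * z ^ 2 + P₁ * z + (3 * s - 2 * t * n₀) = 0 := fun z => by
    simpa using congrArg (Polynomial.eval z) hP
  have evR : ∀ z : ℂ, r₃ * z ^ 3 + r₂ * z ^ 2 = 0 := fun z => by
    simpa using congrArg (Polynomial.eval z) hR
  -- The parameter `s` occurs only in the constant coefficient of P. The other coefficients are
  -- isolated by evaluating at 0, 1 and -1.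
  obtain ⟨hx1, hy1⟩ := DiskIsometry.weights_eq_one (x := x) (y := y) (p := p) (q := q)
    (by norm_cast; positivity) (by norm_cast; positivity) ht0 hpqc he hm hm' hn₁ hn₀
    (by rw [← hr₃]; linear_combination (evR 1 - evR (-1)) / 2)
    (by rw [← hr₂]; linear_combination (evR 1 + evR (-1)) / 2)
    (by rw [← hP₂]; linear_combination (evP 1 + evP (-1)) / 2 - evP 0)
    (by rw [← hP₁]; linear_combination (evP 1 - evP (-1)) / 2)
  have hx1' : x = 1 := by exact_mod_cast hx1
  have hy1' : y = 1 := by exact_mod_cast hy1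
  rw [hx1'] at hx
  rw [hy1'] at hy
  constructor
  · field_simp at hx; exact hx
  · field_simp at hy; exact hy

/-! ### Rigidity for unit weights -/

/-- For unit weights the second derivative at the origin is determined up to a phase. -/
theorem IsCenteredIsometry.norm_deriv_deriv {f g : ℂ → ℂ} (h : IsCenteredIsometry 1 1 f g)
    (hf : deriv f 0 ≠ 0) (hg : deriv g 0 ≠ 0) :
    ‖deriv (deriv f) 0‖ = 2 * (1 - ‖deriv f 0‖ ^ 2) * ‖deriv f 0‖ := by
  obtain ⟨t, s, hpq, hm, ht, -⟩ := h.normal_form one_pos one_pos hf hg rfl rfl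
  have hp0 : 0 < ‖deriv f 0‖ := by positivity
  have hq0 : 0 < ‖deriv g 0‖ := by positivity
  have hq : ‖deriv g 0‖ ^ 2 = 1 - ‖deriv f 0‖ ^ 2 := by linarith
  -- Since p + q = 1, the left side 1 - p² - q² of `hm` equals 2pq.
  have htn : ‖t‖ = 1 := by
    have h2 : ‖t‖ ^ 2 = 1 := by
      have hne : 2 * ‖deriv f 0‖ ^ 2 * ‖deriv g 0‖ ^ 2 ≠ 0 := by positivity
      refine mul_left_cancel₀ hne ?_
      rw [hq] at hm ⊢
      linear_combination -hm
    nlinarith [norm_nonneg t]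
  have := congrArg norm ht
  simp only [norm_mul, RCLike.norm_conj, norm_real, htn, Complex.norm_ofNat, one_mul,
    norm_pow, norm_norm, mul_one] at this
  rw [this, hq]

/-- For unit weights, the two-jet of the first component determines the isometry up to rotations
of the components. -/
theorem IsCenteredIsometry.eq_of_jet {f g F G : ℂ → ℂ} (h : IsCenteredIsometry 1 1 f g)
    (H : IsCenteredIsometry 1 1 F G) (hf : deriv f 0 ≠ 0) (hg : deriv g 0 ≠ 0)
    (hf2 : deriv (deriv f) 0 ≠ 0) (hF : ‖deriv F 0‖ = ‖deriv f 0‖)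
    (hF2 : deriv (deriv f) 0 * deriv F 0 = deriv (deriv F) 0 * deriv f 0) :
    ∃ c d : ℂ, ‖c‖ = 1 ∧ ‖d‖ = 1 ∧ Set.EqOn f (fun z => c * F z) disk ∧
      Set.EqOn g (fun z => d * G z) disk := by
  have hF0 : deriv F 0 ≠ 0 := by
    rw [← norm_pos_iff, hF]; positivity
  have sum : ∀ {f g : ℂ → ℂ}, IsCenteredIsometry 1 1 f g →
      ‖deriv f 0‖ ^ 2 + ‖deriv g 0‖ ^ 2 = 1 := by
    intro f g h
    have := h.moments.1
    simp only [conj_mul_eq_normSq] at this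
    have : (1 : ℝ) * ‖deriv f 0‖ ^ 2 + 1 * ‖deriv g 0‖ ^ 2 = 1 := by exact_mod_cast this
    linarith
  have hG : ‖deriv G 0‖ = ‖deriv g 0‖ := by
    have h1 := sum h
    have h2 := sum H
    rw [hF] at h2
    exact (pow_left_inj₀ (norm_nonneg _) (norm_nonneg _) two_ne_zero).1 (by linarith)
  have hG0 : deriv G 0 ≠ 0 := by
    rw [← norm_pos_iff, hG]; positivity
  obtain ⟨t, s, hpq, -, ht, hrel⟩ := h.normal_form one_pos one_pos hf hg rfl rfl
  obtain ⟨T, S, -, -, hT, Hrel⟩ := H.normal_form one_pos one_pos hF0 hG0 rfl rfl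
  have ht0 : t ≠ 0 := by
    rintro rfl
    apply hf2
    simpa using ht
  have hf' : conj (deriv f 0) ≠ 0 := by simpa using hf
  have hg' : conj (deriv g 0) ≠ 0 := by simpa using hg
  have hF' : conj (deriv F 0) ≠ 0 := by simpa using hF0
  have hG' : conj (deriv G 0) ≠ 0 := by simpa using hG0
  rw [hF, hG] at Hrel
  rw [hG] at hT
  have hq0 : (((1 : ℝ) * ‖deriv g 0‖ ^ 2 : ℝ) : ℂ) ≠ 0 := by
    have : (1 : ℝ) * ‖deriv g 0‖ ^ 2 ≠ 0 := by positivity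
    exact_mod_cast this
  generalize (((1 : ℝ) * ‖deriv g 0‖ ^ 2 : ℝ)) = q at *
  generalize (((1 : ℝ) * ‖deriv f 0‖ ^ 2 : ℝ)) = p at *
  have hpqc : (p : ℂ) + q = 1 := by exact_mod_cast hpq
  obtain rfl : t = T := by
    have := congrArg conj hF2
    rw [map_mul, map_mul, ht, hT] at this
    have hne : 2 * q * conj (deriv f 0) * conj (deriv F 0) ≠ 0 := by
      simp only [ne_eq, mul_eq_zero, hq0, hf', hF', OfNat.ofNat_ne_zero, or_self, not_false_eq_true]
    refine mul_left_cancel₀ hne ?_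
    linear_combination this
  have cf : ContinuousAt f 0 :=
    (h.diff₁.differentiableAt (disk_mem_nhds zero_mem_disk)).continuousAt
  have cF : ContinuousAt F 0 :=
    (H.diff₁.differentiableAt (disk_mem_nhds zero_mem_disk)).continuousAt
  -- Both normalized first components solve the same quadratic equation. The difference of the two
  -- equations factors as the difference of the solutions times this expression, which tends to 2t ≠
  -- 0.
  have hne : ∀ᶠ z in 𝓝 0, 2 * (conj (deriv f 0) * f z + conj (deriv F 0) * F z) - 2 * z + 2 * t
      ≠ 0 := by
    have : ContinuousAt (fun z => 2 * (conj (deriv f 0) * f z + conj (deriv F 0) * F z) -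
        2 * z + 2 * t) 0 := by fun_prop
    exact this.eventually_ne (by simpa [h.zero₁, H.zero₁] using ht0)
  have key : ∀ᶠ z in 𝓝 0, conj (deriv f 0) * f z = conj (deriv F 0) * F z ∧
      conj (deriv g 0) * g z = conj (deriv G 0) * G z := by
    filter_upwards [hne, eventually_mem_half] with z hz hz'
    obtain ⟨r1, r2, -⟩ := hrel z hz' _ _ rfl rfl
    obtain ⟨R1, R2, -⟩ := Hrel z hz' _ _ rfl rfl
    have r1' := eq_sub_of_add_eq' r1
    have R1' := eq_sub_of_add_eq' R1
    rw [r1'] at r2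
    rw [R1'] at R2
    simp only [ofReal_one, one_mul, div_one] at r1 r2 R1 R2
    have hA : conj (deriv f 0) * f z = conj (deriv F 0) * F z := by
      rw [← sub_eq_zero]
      refine (mul_eq_zero.1 ?_).resolve_right hz
      linear_combination r2 - R2 -
        2 * t * (conj (deriv f 0) * f z - conj (deriv F 0) * F z) * hpqc
    refine ⟨hA, ?_⟩
    linear_combination r1 - R1 - hA
  refine ⟨conj (deriv F 0) / conj (deriv f 0), conj (deriv G 0) / conj (deriv g 0), ?_, ?_, ?_, ?_⟩
  · rw [norm_div, RCLike.norm_conj, RCLike.norm_conj, hF]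
    exact div_self (by simpa using hf)
  · rw [norm_div, RCLike.norm_conj, RCLike.norm_conj, hG]
    exact div_self (by simpa using hg)
  · refine eqOn_disk_of_eventuallyEq h.diff₁ (H.diff₁.const_mul _) ?_
    filter_upwards [key] with z hz
    field_simp
    linear_combination hz.1
  · refine eqOn_disk_of_eventuallyEq h.diff₂ (H.diff₂.const_mul _) ?_
    filter_upwards [key] with z hz
    field_simp
    linear_combination hz.2

theorem mul_mem_disk {η : ℂ} (hη : ‖η‖ = 1) {z : ℂ} (hz : z ∈ disk) : η * z ∈ disk := by
  simpa [disk, hη] using hz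

theorem deriv_comp_const_mul (f : ℂ → ℂ) (η : ℂ) :
    deriv (fun z => f (η * z)) = fun z => η * deriv f (η * z) := by
  funext z
  simpa using deriv_comp_mul_left η f z

theorem IsCenteredIsometry.comp_rotation {l₁ l₂ : ℝ} {f g : ℂ → ℂ}
    (h : IsCenteredIsometry l₁ l₂ f g) {η : ℂ} (hη : ‖η‖ = 1) :
    IsCenteredIsometry l₁ l₂ (fun z => f (η * z)) (fun z => g (η * z)) where
  diff₁ := h.diff₁.comp (by fun_prop) fun _ hz => mul_mem_disk hη hz
  diff₂ := h.diff₂.comp (by fun_prop) fun _ hz => mul_mem_disk hη hz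
  mapsTo₁ := fun _ hz => h.mapsTo₁ (mul_mem_disk hη hz)
  mapsTo₂ := fun _ hz => h.mapsTo₂ (mul_mem_disk hη hz)
  metric := fun z hz => by
    have := h.metric _ (mul_mem_disk hη hz)
    rw [norm_mul, hη, one_mul] at this
    simpa only [deriv_comp_const_mul, norm_mul, hη, one_mul] using this
  zero₁ := by simp [h.zero₁]
  zero₂ := by simp [h.zero₂]

/-- For unit weights, a centered isometry is determined, up to rotations of the disk and of the
components, by the norm of the derivative of its first component at the origin. -/
theorem IsCenteredIsometry.eq_up_to_rotation {f g F G : ℂ → ℂ} (h : IsCenteredIsometry 1 1 f g)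
    (H : IsCenteredIsometry 1 1 F G) (hf : deriv f 0 ≠ 0) (hg : deriv g 0 ≠ 0)
    (hf2 : deriv (deriv f) 0 ≠ 0) (hF : ‖deriv F 0‖ = ‖deriv f 0‖) (hG : deriv G 0 ≠ 0) :
    ∃ η c d : ℂ, ‖η‖ = 1 ∧ ‖c‖ = 1 ∧ ‖d‖ = 1 ∧
      Set.EqOn f (fun z => c * F (η * z)) disk ∧ Set.EqOn g (fun z => d * G (η * z)) disk := by
  have hF0 : deriv F 0 ≠ 0 := by
    rw [← norm_pos_iff, hF]; positivity
  have n1 := h.norm_deriv_deriv hf hg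
  have n2 := H.norm_deriv_deriv hF0 hG
  rw [hF, ← n1] at n2
  have hF2 : deriv (deriv F) 0 ≠ 0 := by
    rw [← norm_pos_iff, n2]; positivity
  -- Rotating the source by η multiplies F'(0) by η and F''(0) by η². This η matches the ratio of
  -- second to first derivative with that of f, and it is unimodular because the norms already
  -- agree.
  set η := deriv (deriv f) 0 * deriv F 0 / (deriv (deriv F) 0 * deriv f 0) with hη_def
  have hη : ‖η‖ = 1 := by
    rw [hη_def, norm_div, norm_mul, norm_mul, hF, n2]
    exact div_self (by positivity)
  have hη0 : η ≠ 0 := by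
    rw [← norm_pos_iff, hη]; exact one_pos
  have hd1 := deriv_comp_const_mul F η
  have hd2 : deriv (deriv fun z => F (η * z)) 0 = η * (η * deriv (deriv F) 0) := by
    rw [hd1, deriv_const_mul_field, deriv_comp_const_mul]
    simp
  obtain ⟨c, d, hc, hd, e1, e2⟩ := h.eq_of_jet (H.comp_rotation hη) hf hg hf2
    (by rw [hd1]; simp [hη, hF]) (by
      rw [hd2, hd1]
      simp only [mul_zero]
      rw [hη_def]
      field_simp)
  exact ⟨η, c, d, hη, hc, hd, e1, e2⟩

/-! ### Passage to components, and automorphisms of the disk and bidisk -/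

/-- For holomorphic components every pulled back metric is a scalar multiple of Re(u conj v). The
tensor identity is therefore equivalent to its case u = v = 1. -/
theorem isHolomorphicIsometry_iff {l₁ l₂ : ℝ} {F : ℂ → ℂ × ℂ} :
    IsHolomorphicIsometry l₁ l₂ F ↔
      IsIsometryPair l₁ l₂ (fun z => (F z).1) (fun z => (F z).2) := by
  have fd : ∀ {f g : ℂ → ℂ} {z : ℂ}, DifferentiableOn ℂ f disk → DifferentiableOn ℂ g disk →
      z ∈ disk → ∀ u : ℂ, fderiv ℂ (fun z => (f z, g z)) z u = (u * deriv f z, u * deriv g z) := by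
    intro f g z hf hg hz u
    have df := (hf.differentiableAt (disk_mem_nhds hz)).hasDerivAt
    have dg := (hg.differentiableAt (disk_mem_nhds hz)).hasDerivAt
    rw [(df.prodMk dg).hasFDerivAt.fderiv]
    simp
  have metric : ∀ w z a u v : ℂ, poincareMetric w (u * a) (v * a) =
      2 * (u * conj v).re * (‖a‖ ^ 2 / (1 - ‖w‖ ^ 2) ^ 2) := by
    intro w z a u v
    have : u * a * conj (v * a) = ((‖a‖ ^ 2 : ℝ) : ℂ) * (u * conj v) := by
      rw [← conj_mul_eq_normSq, map_mul]; ring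
    rw [poincareMetric, this, re_ofReal_mul]
    ring
  constructor
  · intro h
    have d1 : DifferentiableOn ℂ (fun z => (F z).1) disk := h.holomorphic.fst
    have d2 : DifferentiableOn ℂ (fun z => (F z).2) disk := h.holomorphic.snd
    refine ⟨d1, d2, fun z hz => (h.mapsTo hz).1, fun z hz => (h.mapsTo hz).2, fun z hz => ?_⟩
    have := h.pullback z hz 1 1
    rw [fd (f := fun z => (F z).1) (g := fun z => (F z).2) d1 d2 hz, bidiskMetric] at this
    simp only [metric _ z] at this
    simp only [poincareMetric, map_one, mul_one, one_re] at this
    linear_combination this / 2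
  · intro h
    refine ⟨h.diff₁.prodMk h.diff₂, fun z hz => ⟨h.mapsTo₁ hz, h.mapsTo₂ hz⟩, fun z hz u v => ?_⟩
    rw [fd (f := fun z => (F z).1) (g := fun z => (F z).2) h.diff₁ h.diff₂ hz,
      fd (f := fun z => (F z).1) (g := fun z => (F z).2) h.diff₁ h.diff₂ hz, bidiskMetric]
    simp only [metric _ z]
    rw [poincareMetric]
    linear_combination 2 * (u * conj v).re * h.metric z hz

section Aut

theorem IsHolomorphicAut.comp {E : Type*} [NormedAddCommGroup E] [NormedSpace ℂ E] {U : Set E}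
    {φ φ' : E → E} (h : IsHolomorphicAut U φ) (h' : IsHolomorphicAut U φ') :
    IsHolomorphicAut U (φ ∘ φ') := by
  obtain ⟨d, m, ψ, e, n, l, r⟩ := h
  obtain ⟨d', m', ψ', e', n', l', r'⟩ := h'
  exact ⟨d.comp d' m', m.comp m', ψ' ∘ ψ, e'.comp e n, n'.comp n, l'.comp l m',
    fun x hx => by
    simp only [Function.comp_apply, r' (n hx), r hx]⟩

theorem isHolomorphicAut_id {E : Type*} [NormedAddCommGroup E] [NormedSpace ℂ E] (U : Set E) :
    IsHolomorphicAut U id :=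
  ⟨differentiableOn_id, Set.mapsTo_id U, id, differentiableOn_id, Set.mapsTo_id U,
    fun _ _ => rfl, fun _ _ => rfl⟩

theorem IsHolomorphicAut.prodMap {α β : ℂ → ℂ} (h : IsHolomorphicAut disk α)
    (h' : IsHolomorphicAut disk β) : IsHolomorphicAut bidisk (Prod.map α β) := by
  obtain ⟨d, m, ψ, e, n, l, r⟩ := h
  obtain ⟨d', m', ψ', e', n', l', r'⟩ := h'
  have diff : ∀ {a b : ℂ → ℂ}, DifferentiableOn ℂ a disk → DifferentiableOn ℂ b disk →
      DifferentiableOn ℂ (Prod.map a b) bidisk := fun ha hb =>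
    (ha.comp differentiableOn_fst fun w hw => hw.1).prodMk
      (hb.comp differentiableOn_snd fun w hw => hw.2)
  exact ⟨diff d d', m.prodMap m', Prod.map ψ ψ', diff e e', n.prodMap n',
    fun w hw => Prod.ext (l hw.1) (l' hw.2), fun w hw => Prod.ext (r hw.1) (r' hw.2)⟩

theorem isHolomorphicAut_rotation {η : ℂ} (hη : ‖η‖ = 1) :
    IsHolomorphicAut disk (fun z => η * z) := by
  have h0 : η ≠ 0 := by rw [← norm_pos_iff, hη]; exact one_pos
  refine ⟨by fun_prop, fun _ hz => mul_mem_disk hη hz, fun z => η⁻¹ * z, by fun_prop,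
    fun _ hz => mul_mem_disk (by rw [norm_inv, hη, inv_one]) hz, fun z _ => ?_, fun z _ => ?_⟩
  · field_simp
  · field_simp

/-- The Möbius involution of the disk exchanging `0` and `a`. -/
def mobius (a z : ℂ) : ℂ := (a - z) / (1 - conj a * z)

theorem mobius_zero (a : ℂ) : mobius a 0 = a := by simp [mobius]

theorem mobius_self (a : ℂ) : mobius a a = 0 := by simp [mobius]

variable {a z : ℂ}

theorem one_sub_norm_mobius_sq (ha : a ∈ disk) (hz : z ∈ disk) :
    1 - ‖mobius a z‖ ^ 2 = (1 - ‖a‖ ^ 2) * (1 - ‖z‖ ^ 2) / ‖1 - conj a * z‖ ^ 2 := by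
  have hne := one_sub_mul_ne_zero (conj_mem_disk ha) hz
  have hpos : ‖1 - conj a * z‖ ^ 2 ≠ 0 := by simpa using hne
  rw [mobius, norm_div, div_pow, eq_div_iff hpos, sub_mul, div_mul_cancel₀ _ hpos]
  simp only [Complex.sq_norm, normSq_apply, sub_re, sub_im, mul_re, mul_im, conj_re, conj_im,
    one_re, one_im]
  ring

theorem mobius_mem_disk (ha : a ∈ disk) (hz : z ∈ disk) : mobius a z ∈ disk := by
  have hne := one_sub_mul_ne_zero (conj_mem_disk ha) hz
  have h := one_sub_norm_mobius_sq ha hz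
  have h1 := one_sub_normSq_pos ha
  have h2 := one_sub_normSq_pos hz
  have : 0 < 1 - ‖mobius a z‖ ^ 2 := by rw [h]; positivity
  simp only [disk, mem_ball_zero_iff]
  nlinarith [norm_nonneg (mobius a z)]

theorem hasDerivAt_mobius (ha : a ∈ disk) (hz : z ∈ disk) :
    HasDerivAt (mobius a) (-((1 - ‖a‖ ^ 2 : ℝ) : ℂ) / (1 - conj a * z) ^ 2) z := by
  have hne := one_sub_mul_ne_zero (conj_mem_disk ha) hz
  refine (((hasDerivAt_id z).const_sub a).div
    (((hasDerivAt_id z).const_mul (conj a)).const_sub 1) hne).congr_deriv ?_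
  have := conj_mul_eq_normSq a
  push_cast at this ⊢
  rw [← this]
  simp only [id]
  congr 1
  ring

theorem differentiableOn_mobius (ha : a ∈ disk) : DifferentiableOn ℂ (mobius a) disk :=
  fun _ hz => (hasDerivAt_mobius ha hz).differentiableAt.differentiableWithinAt

theorem norm_deriv_mobius (ha : a ∈ disk) (hz : z ∈ disk) :
    ‖deriv (mobius a) z‖ * (1 - ‖z‖ ^ 2) = 1 - ‖mobius a z‖ ^ 2 := by
  rw [(hasDerivAt_mobius ha hz).deriv, one_sub_norm_mobius_sq ha hz, norm_div, norm_neg,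
    norm_real, Real.norm_of_nonneg (one_sub_normSq_pos ha).le, norm_pow]
  ring

theorem mobius_mobius (ha : a ∈ disk) (hz : z ∈ disk) : mobius a (mobius a z) = z := by
  have h1 := one_sub_mul_ne_zero (conj_mem_disk ha) hz
  have h2 := one_sub_mul_ne_zero (conj_mem_disk ha) (mobius_mem_disk ha hz)
  have h3 : mobius a z * (1 - conj a * z) = a - z := div_mul_cancel₀ _ h1
  rw [mobius, div_eq_iff h2]
  linear_combination -h3

theorem isHolomorphicAut_mobius (ha : a ∈ disk) : IsHolomorphicAut disk (mobius a) :=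
  ⟨differentiableOn_mobius ha, fun _ hz => mobius_mem_disk ha hz, mobius a,
    differentiableOn_mobius ha, fun _ hz => mobius_mem_disk ha hz,
    fun _ hz => mobius_mobius ha hz, fun _ hz => mobius_mobius ha hz⟩

end Aut

/-! ### Recentring an isometry -/

/-- Postcomposition with a Möbius involution does not change the pulled back metric, and
precomposition transforms it by the metric of the disk. -/
theorem norm_deriv_mobius_comp {a b z : ℂ} (ha : a ∈ disk) (hb : b ∈ disk) {f : ℂ → ℂ}
    (hf : DifferentiableOn ℂ f disk) (hm : Set.MapsTo f disk disk) (hz : z ∈ disk) :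
    ‖deriv (fun z => mobius b (f (mobius a z))) z‖ ^ 2 /
        (1 - ‖mobius b (f (mobius a z))‖ ^ 2) ^ 2 =
      ‖deriv f (mobius a z)‖ ^ 2 / (1 - ‖f (mobius a z)‖ ^ 2) ^ 2 *
        ((1 - ‖mobius a z‖ ^ 2) ^ 2 / (1 - ‖z‖ ^ 2) ^ 2) := by
  have hz' := mobius_mem_disk ha hz
  have d := (hasDerivAt_mobius hb (hm hz')).differentiableAt.hasDerivAt.comp z
    (((hf.differentiableAt (disk_mem_nhds hz')).hasDerivAt.comp z
      (hasDerivAt_mobius ha hz).differentiableAt.hasDerivAt))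
  have e : deriv (fun z => mobius b (f (mobius a z))) z = _ := d.deriv
  have p1 := one_sub_normSq_pos (hm hz')
  have p2 := one_sub_normSq_pos hz
  have p3 := one_sub_normSq_pos (mobius_mem_disk hb (hm hz'))
  have n1 := norm_deriv_mobius hb (hm hz')
  have n2 := norm_deriv_mobius ha hz
  rw [e, norm_mul, norm_mul, ← n2]
  rw [← n1] at p3 ⊢
  have p4 : ‖deriv (mobius b) (f (mobius a z))‖ ≠ 0 := fun h => by simp [h] at p3
  field_simp

theorem IsIsometryPair.center {l₁ l₂ : ℝ} {f g : ℂ → ℂ} (h : IsIsometryPair l₁ l₂ f g) {a : ℂ}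
    (ha : a ∈ disk) :
    IsCenteredIsometry l₁ l₂ (fun z => mobius (f a) (f (mobius a z)))
      (fun z => mobius (g a) (g (mobius a z))) where
  diff₁ := (differentiableOn_mobius (h.mapsTo₁ ha)).comp
    (h.diff₁.comp (differentiableOn_mobius ha) fun _ hz => mobius_mem_disk ha hz)
    fun _ hz => h.mapsTo₁ (mobius_mem_disk ha hz)
  diff₂ := (differentiableOn_mobius (h.mapsTo₂ ha)).comp
    (h.diff₂.comp (differentiableOn_mobius ha) fun _ hz => mobius_mem_disk ha hz)
    fun _ hz => h.mapsTo₂ (mobius_mem_disk ha hz)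
  mapsTo₁ := fun _ hz => mobius_mem_disk (h.mapsTo₁ ha) (h.mapsTo₁ (mobius_mem_disk ha hz))
  mapsTo₂ := fun _ hz => mobius_mem_disk (h.mapsTo₂ ha) (h.mapsTo₂ (mobius_mem_disk ha hz))
  zero₁ := by simp only [mobius_zero, mobius_self]
  zero₂ := by simp only [mobius_zero, mobius_self]
  metric := fun z hz => by
    have p1 := one_sub_normSq_pos (mobius_mem_disk ha hz)
    have p2 := one_sub_normSq_pos hz
    have hm := h.metric _ (mobius_mem_disk ha hz)
    rw [mul_div_assoc, mul_div_assoc, norm_deriv_mobius_comp ha (h.mapsTo₁ ha) h.diff₁ h.mapsTo₁ hz,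
      norm_deriv_mobius_comp ha (h.mapsTo₂ ha) h.diff₂ h.mapsTo₂ hz]
    have e : (1 : ℝ) / (1 - ‖z‖ ^ 2) ^ 2 = 1 / (1 - ‖mobius a z‖ ^ 2) ^ 2 *
        ((1 - ‖mobius a z‖ ^ 2) ^ 2 / (1 - ‖z‖ ^ 2) ^ 2) := by field_simp
    rw [e, ← hm]
    ring

/-! ### The Cayley transform and the square root embedding -/

theorem one_sub_ne_zero_of_mem_disk {z : ℂ} (hz : z ∈ disk) : 1 - z ≠ 0 := by
  intro h
  have : z = 1 := (sub_eq_zero.1 h).symm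
  simp [disk, this] at hz

theorem im_toHalfPlane {z : ℂ} (hz : z ∈ disk) :
    (toHalfPlane z).im = (1 - ‖z‖ ^ 2) / ‖1 - z‖ ^ 2 := by
  have hne := one_sub_ne_zero_of_mem_disk hz
  have h : normSq (1 - z) ≠ 0 := by simpa using hne
  rw [toHalfPlane, div_im, Complex.sq_norm, Complex.sq_norm]
  field_simp
  simp [normSq_apply]
  ring

theorem im_toHalfPlane_pos {z : ℂ} (hz : z ∈ disk) : 0 < (toHalfPlane z).im := by
  have hne := one_sub_ne_zero_of_mem_disk hz
  have := one_sub_normSq_pos hz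
  rw [im_toHalfPlane hz]
  positivity

theorem hasDerivAt_toHalfPlane {z : ℂ} (hz : z ∈ disk) :
    HasDerivAt toHalfPlane (2 * I / (1 - z) ^ 2) z := by
  have hne := one_sub_ne_zero_of_mem_disk hz
  refine ((((hasDerivAt_id z).const_add 1).const_mul I).div
    ((hasDerivAt_id z).const_sub 1) hne).congr_deriv ?_
  simp only [id]
  congr 1
  ring

theorem norm_deriv_toHalfPlane {z : ℂ} (hz : z ∈ disk) :
    ‖2 * I / (1 - z) ^ 2‖ = 2 * (toHalfPlane z).im / (1 - ‖z‖ ^ 2) := by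
  have := one_sub_normSq_pos hz
  rw [im_toHalfPlane hz]
  simp only [norm_div, norm_mul, norm_I, norm_pow, Complex.norm_ofNat]
  field_simp

theorem toHalfPlane_toDisk {w : ℂ} (hw : w + I ≠ 0) : toHalfPlane (toDisk w) = w := by
  have h2 : 1 - toDisk w = 2 * I / (w + I) := by
    rw [toDisk]; field_simp; ring
  rw [toHalfPlane, h2, toDisk]
  field_simp
  ring

section UpperHalfPlane

variable {w : ℂ}

theorem add_I_ne_zero (hw : 0 < w.im) : w + I ≠ 0 := by
  intro h
  have := congrArg im h
  simp at this
  linarith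

theorem one_sub_norm_toDisk_sq (hw : 0 < w.im) :
    1 - ‖toDisk w‖ ^ 2 = 4 * w.im / ‖w + I‖ ^ 2 := by
  have hne := add_I_ne_zero hw
  have hpos : ‖w + I‖ ^ 2 ≠ 0 := by simpa using hne
  rw [toDisk, norm_div, div_pow, eq_div_iff hpos, sub_mul, div_mul_cancel₀ _ hpos]
  simp only [Complex.sq_norm, normSq_apply, sub_re, sub_im, add_re, add_im, I_re, I_im]
  ring

theorem toDisk_mem_disk (hw : 0 < w.im) : toDisk w ∈ disk := by
  have hne := add_I_ne_zero hw
  have : 0 < 1 - ‖toDisk w‖ ^ 2 := by rw [one_sub_norm_toDisk_sq hw]; positivity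
  simp only [disk, mem_ball_zero_iff]
  nlinarith [norm_nonneg (toDisk w)]

theorem hasDerivAt_toDisk (hw : 0 < w.im) : HasDerivAt toDisk (2 * I / (w + I) ^ 2) w := by
  refine (((hasDerivAt_id w).sub_const I).div ((hasDerivAt_id w).add_const I)
    (add_I_ne_zero hw)).congr_deriv ?_
  simp only [id]
  congr 1
  ring

/-- The pullback of the Poincaré metric through the Cayley transform is the hyperbolic metric. -/
theorem metric_toDisk_comp {k : ℂ → ℂ} {k' z : ℂ} (hk : HasDerivAt k k' z) (hw : 0 < (k z).im) :
    ‖deriv (fun z => toDisk (k z)) z‖ ^ 2 / (1 - ‖toDisk (k z)‖ ^ 2) ^ 2 =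
      (‖k'‖ / (2 * (k z).im)) ^ 2 := by
  have e : deriv (fun z => toDisk (k z)) z = 2 * I / (k z + I) ^ 2 * k' :=
    ((hasDerivAt_toDisk hw).comp z hk).deriv
  have hne := add_I_ne_zero hw
  have hpos : ‖k z + I‖ ≠ 0 := by simpa using hne
  rw [e, one_sub_norm_toDisk_sq hw]
  simp only [norm_mul, norm_div, norm_I, norm_pow, Complex.norm_ofNat]
  field_simp
  ring

theorem sqrt_re_pos (hw : 0 < w.im) : 0 < (w ^ (1 / 2 : ℂ)).re := by
  have h0 : w ≠ 0 := by rintro rfl; simp at hw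
  have h1 := arg_lt_pi_iff.2 (Or.inr hw.ne')
  have h2 := arg_nonneg_iff.2 hw.le
  rw [cpow_def_of_ne_zero h0, exp_re]
  have : (log w * (1 / 2)).im = w.arg / 2 := by simp [mul_im, log_im]; ring
  rw [this]
  exact mul_pos (Real.exp_pos _) (Real.cos_pos_of_mem_Ioo ⟨by linarith [Real.pi_pos], by linarith⟩)

theorem sqrt_sq (w : ℂ) : (w ^ (1 / 2 : ℂ)) ^ 2 = w := by
  rw [one_div]
  exact_mod_cast cpow_nat_inv_pow w two_ne_zero

theorem two_mul_sqrt_re_mul_im (w : ℂ) :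
    2 * (w ^ (1 / 2 : ℂ)).re * (w ^ (1 / 2 : ℂ)).im = w.im := by
  conv_rhs => rw [← sqrt_sq w]
  rw [sq, mul_im]
  ring

theorem sqrt_im_pos (hw : 0 < w.im) : 0 < (w ^ (1 / 2 : ℂ)).im := by
  have h1 := two_mul_sqrt_re_mul_im w
  have h2 := sqrt_re_pos hw
  by_contra! h
  nlinarith

end UpperHalfPlane

/-- The branch of `√τ` used by the square root embedding, in the disk coordinate. -/
def diskSqrt (z : ℂ) : ℂ := toHalfPlane z ^ (1 / 2 : ℂ)

theorem sqrtEmbedding_eq (z : ℂ) :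
    sqrtEmbedding z = (toDisk (diskSqrt z), toDisk (I * diskSqrt z)) := by
  have : Complex.exp (Real.pi * I / 2) = I := by
    rw [show (Real.pi * I / 2 : ℂ) = Real.pi / 2 * I by ring, exp_pi_div_two_mul_I]
  simp only [sqrtEmbedding, halfPlaneSqrt, diskSqrt, this]

/-- Writing s = √τ, differentiate s² = τ and use |τ'| = 2 Im τ/(1 - |z|²) together with Im τ = 2 Re
s Im s. -/
theorem hasDerivAt_diskSqrt {z : ℂ} (hz : z ∈ disk) :
    ∃ s', HasDerivAt diskSqrt s' z ∧ ‖s'‖ =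
      2 * (diskSqrt z).re * (diskSqrt z).im / (‖diskSqrt z‖ * (1 - ‖z‖ ^ 2)) := by
  have hτ := im_toHalfPlane_pos hz
  have hd : DifferentiableAt ℂ diskSqrt z :=
    (hasDerivAt_toHalfPlane hz).differentiableAt.cpow_const (Or.inr hτ.ne')
  refine ⟨_, hd.hasDerivAt, ?_⟩
  have h1 : HasDerivAt toHalfPlane (2 * diskSqrt z * deriv diskSqrt z) z := by
    have := hd.hasDerivAt.pow 2
    refine (this.congr_deriv (by push_cast; ring)).congr_of_eventuallyEq ?_
    exact Eventually.of_forall fun w => (sqrt_sq _).symm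
  have h2 := congrArg norm (h1.unique (hasDerivAt_toHalfPlane hz))
  rw [norm_deriv_toHalfPlane hz, norm_mul, norm_mul, Complex.norm_ofNat,
    ← two_mul_sqrt_re_mul_im] at h2
  have hre : 0 < (diskSqrt z).re := sqrt_re_pos hτ
  have h0 : 0 < ‖diskSqrt z‖ := by
    rw [norm_pos_iff]; intro h; simp [h] at hre
  have hp := one_sub_normSq_pos hz
  change 2 * ‖diskSqrt z‖ * _ = 2 * (2 * (diskSqrt z).re * (diskSqrt z).im) / _ at h2
  field_simp at h2 ⊢
  linarith

/-- With θ the argument of √τ, the two components carry the shares cos² θ and sin² θ of the Poincaré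
metric. This is why the square root embedding is an isometry, and why its shares vary with the
point. -/
theorem metric_sqrt₁ {z : ℂ} (hz : z ∈ disk) :
    ‖deriv (fun z => toDisk (diskSqrt z)) z‖ ^ 2 / (1 - ‖toDisk (diskSqrt z)‖ ^ 2) ^ 2 =
      (diskSqrt z).re ^ 2 / (‖diskSqrt z‖ * (1 - ‖z‖ ^ 2)) ^ 2 := by
  have hτ := im_toHalfPlane_pos hz
  have him : 0 < (diskSqrt z).im := sqrt_im_pos hτ
  obtain ⟨s', hs, hn⟩ := hasDerivAt_diskSqrt hz
  rw [metric_toDisk_comp hs him, hn, ← div_pow]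
  congr 1
  field_simp

theorem metric_sqrt₂ {z : ℂ} (hz : z ∈ disk) :
    ‖deriv (fun z => toDisk (I * diskSqrt z)) z‖ ^ 2 / (1 - ‖toDisk (I * diskSqrt z)‖ ^ 2) ^ 2 =
      (diskSqrt z).im ^ 2 / (‖diskSqrt z‖ * (1 - ‖z‖ ^ 2)) ^ 2 := by
  have hτ := im_toHalfPlane_pos hz
  have hre : 0 < (diskSqrt z).re := sqrt_re_pos hτ
  obtain ⟨s', hs, hn⟩ := hasDerivAt_diskSqrt hz
  rw [metric_toDisk_comp (hs.const_mul I) (by simpa using hre), norm_mul, norm_I, one_mul, hn,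
    ← div_pow, I_mul_im]
  congr 1
  field_simp

theorem isIsometryPair_sqrt :
    IsIsometryPair 1 1 (fun z => toDisk (diskSqrt z)) (fun z => toDisk (I * diskSqrt z)) where
  diff₁ := fun z hz => by
    obtain ⟨s', hs, -⟩ := hasDerivAt_diskSqrt hz
    exact ((hasDerivAt_toDisk (sqrt_im_pos (im_toHalfPlane_pos hz))).comp z
      hs).differentiableAt.differentiableWithinAt
  diff₂ := fun z hz => by
    obtain ⟨s', hs, -⟩ := hasDerivAt_diskSqrt hz
    have him : 0 < (I * diskSqrt z).im := by
      rw [I_mul_im]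
      exact sqrt_re_pos (im_toHalfPlane_pos hz)
    exact ((hasDerivAt_toDisk him).comp z
      (hs.const_mul I)).differentiableAt.differentiableWithinAt
  mapsTo₁ := fun z hz => toDisk_mem_disk (sqrt_im_pos (im_toHalfPlane_pos hz))
  mapsTo₂ := fun z hz => toDisk_mem_disk (by
    rw [I_mul_im]
    exact sqrt_re_pos (im_toHalfPlane_pos hz))
  metric := fun z hz => by
    have hp := one_sub_normSq_pos hz
    have hre : 0 < (diskSqrt z).re := sqrt_re_pos (im_toHalfPlane_pos hz)
    have h0 : 0 < ‖diskSqrt z‖ := by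
      rw [norm_pos_iff]; intro h; simp [h] at hre
    rw [one_mul, one_mul, metric_sqrt₁ hz, metric_sqrt₂ hz, ← add_div, mul_pow]
    have : (diskSqrt z).re ^ 2 + (diskSqrt z).im ^ 2 = ‖diskSqrt z‖ ^ 2 := by
      rw [Complex.sq_norm, normSq_apply]; ring
    rw [this]
    field_simp

/-- Every value in `(0, 1)` occurs as the share of the first component in the pulled back metric
of the square root embedding. -/
theorem exists_sqrt_share {p : ℝ} (h0 : 0 < p) (h1 : p < 1) :
    ∃ a ∈ disk, (diskSqrt a).re ^ 2 = p * ‖diskSqrt a‖ ^ 2 := by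
  -- A unit vector with real part squared equal to p; its square lies in the upper half-plane. The
  -- chosen branch returns s or -s, and the share is the same for both.
  set s : ℂ := ⟨√p, √(1 - p)⟩ with hs
  have hp := Real.sqrt_pos.2 h0
  have hq := Real.sqrt_pos.2 (sub_pos.2 h1)
  have him : 0 < (s ^ 2).im := by
    rw [sq, mul_im, hs]; positivity
  refine ⟨toDisk (s ^ 2), toDisk_mem_disk him, ?_⟩
  have hsq : diskSqrt (toDisk (s ^ 2)) ^ 2 = s ^ 2 := by
    rw [diskSqrt, sqrt_sq, toHalfPlane_toDisk (add_I_ne_zero him)]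
  have hn : ‖s‖ ^ 2 = 1 := by
    rw [Complex.sq_norm, normSq_apply, hs, Real.mul_self_sqrt h0.le,
      Real.mul_self_sqrt (sub_pos.2 h1).le]
    ring
  have hr : s.re ^ 2 = p := Real.sq_sqrt h0.le
  rcases sq_eq_sq_iff_eq_or_eq_neg.1 hsq with h | h
  · rw [h, hn, hr, mul_one]
  · rw [h, norm_neg, hn, neg_re, neg_sq, hr, mul_one]

/-! ### Reparametrizations and the classification -/

/-- `F = Ψ ∘ G ∘ φ` on the disk for automorphisms `φ` of the disk and `Ψ` of the bidisk. -/
def IsReparam (F G : ℂ → ℂ × ℂ) : Prop :=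
  ∃ (φ : ℂ → ℂ) (Ψ : ℂ × ℂ → ℂ × ℂ),
    IsHolomorphicAut disk φ ∧ IsHolomorphicAut bidisk Ψ ∧ Set.EqOn F (Ψ ∘ G ∘ φ) disk

theorem IsReparam.trans {F G H : ℂ → ℂ × ℂ} (h : IsReparam F G) (h' : IsReparam G H) :
    IsReparam F H := by
  obtain ⟨φ, Ψ, hφ, hΨ, e⟩ := h
  obtain ⟨φ', Ψ', hφ', hΨ', e'⟩ := h'
  refine ⟨φ' ∘ φ, Ψ ∘ Ψ', hφ'.comp hφ, hΨ.comp hΨ', fun z hz => ?_⟩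
  rw [e hz]
  simp only [Function.comp_apply]
  rw [e' (hφ.2.1 hz)]
  rfl

theorem isReparam_center {f g : ℂ → ℂ} (hf : Set.MapsTo f disk disk)
    (hg : Set.MapsTo g disk disk) {a : ℂ} (ha : a ∈ disk) :
    IsReparam (fun z => (mobius (f a) (f (mobius a z)), mobius (g a) (g (mobius a z))))
      (fun z => (f z, g z)) :=
  ⟨_, _, isHolomorphicAut_mobius ha,
    (isHolomorphicAut_mobius (hf ha)).prodMap (isHolomorphicAut_mobius (hg ha)), fun _ _ => rfl⟩

/-- Möbius involutions are their own inverses, so the maps that recentre the isometry also undo the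
recentring. -/
theorem isReparam_of_center {f g : ℂ → ℂ} (hf : Set.MapsTo f disk disk)
    (hg : Set.MapsTo g disk disk) {a : ℂ} (ha : a ∈ disk) :
    IsReparam (fun z => (f z, g z))
      (fun z => (mobius (f a) (f (mobius a z)), mobius (g a) (g (mobius a z)))) := by
  refine ⟨_, _, isHolomorphicAut_mobius ha,
    (isHolomorphicAut_mobius (hf ha)).prodMap (isHolomorphicAut_mobius (hg ha)), fun z hz => ?_⟩
  simp only [Function.comp_apply, Prod.map_apply, mobius_mobius ha hz, mobius_mobius (hf ha) (hf hz),
    mobius_mobius (hg ha) (hg hz)]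

theorem isHolomorphicIsometry_fst (l₂ : ℝ) :
    IsHolomorphicIsometry 1 l₂ (fun z => (z, 0)) :=
  isHolomorphicIsometry_iff.2 ⟨differentiableOn_id, differentiableOn_const 0, fun _ hz => hz,
    fun _ _ => zero_mem_disk, fun z _ => by simp⟩

theorem isHolomorphicIsometry_snd (l₁ : ℝ) :
    IsHolomorphicIsometry l₁ 1 (fun z => (0, z)) :=
  isHolomorphicIsometry_iff.2 ⟨differentiableOn_const 0, differentiableOn_id,
    fun _ _ => zero_mem_disk, fun _ hz => hz, fun z _ => by simp⟩

theorem isHolomorphicIsometry_diag {l₁ l₂ : ℝ} (h : l₁ + l₂ = 1) :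
    IsHolomorphicIsometry l₁ l₂ (fun z => (z, z)) :=
  isHolomorphicIsometry_iff.2 ⟨differentiableOn_id, differentiableOn_id,
    fun _ hz => hz, fun _ hz => hz, fun z _ => by rw [← h]; simp; ring⟩

theorem isHolomorphicIsometry_sqrt : IsHolomorphicIsometry 1 1 sqrtEmbedding := by
  rw [isHolomorphicIsometry_iff]
  simpa only [sqrtEmbedding_eq] using isIsometryPair_sqrt

/-- A centered isometry with unit weights whose first component has nonvanishing second derivative
at the origin is a reparametrization of the square root embedding. -/
theorem IsCenteredIsometry.isReparam_sqrt {f g : ℂ → ℂ} (h : IsCenteredIsometry 1 1 f g)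
    (hf : deriv f 0 ≠ 0) (hg : deriv g 0 ≠ 0) (hf2 : deriv (deriv f) 0 ≠ 0) :
    IsReparam (fun z => (f z, g z)) sqrtEmbedding := by
  have sum : ∀ {f g : ℂ → ℂ}, IsCenteredIsometry 1 1 f g →
      ‖deriv f 0‖ ^ 2 + ‖deriv g 0‖ ^ 2 = 1 := fun h => by
    simpa [h.zero₁, h.zero₂] using h.metric 0 zero_mem_disk
  have hp : 0 < ‖deriv f 0‖ ^ 2 := by positivity
  have hq : 0 < ‖deriv g 0‖ ^ 2 := by positivity
  have hpq := sum h
  -- The base point a is where the first component of the square root embedding has share |f'(0)|².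
  -- Recentring at a turns this share into the squared derivative at the origin.
  obtain ⟨a, ha, hs⟩ := exists_sqrt_share hp (by linarith)
  have H := isIsometryPair_sqrt.center ha
  have hpa := one_sub_normSq_pos ha
  have h0 : 0 < ‖diskSqrt a‖ := by
    have hre : 0 < (diskSqrt a).re := sqrt_re_pos (im_toHalfPlane_pos ha)
    rw [norm_pos_iff]; intro h; simp [h] at hre
  have hF := norm_deriv_mobius_comp ha (isIsometryPair_sqrt.mapsTo₁ ha) isIsometryPair_sqrt.diff₁
    isIsometryPair_sqrt.mapsTo₁ zero_mem_disk
  simp only [mobius_zero, mobius_self] at hF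
  rw [metric_sqrt₁ ha, hs] at hF
  have hF' : ‖deriv (fun z => mobius (toDisk (diskSqrt a)) (toDisk (diskSqrt (mobius a z)))) 0‖ ^ 2
      = ‖deriv f 0‖ ^ 2 := by
    simp only [norm_zero] at hF
    field_simp at hF
    simpa using hF
  have hG := sum H
  rw [hF'] at hG
  obtain ⟨η, c, d, hη, hc, hd, e1, e2⟩ := h.eq_up_to_rotation H hf hg hf2
    ((pow_left_inj₀ (norm_nonneg _) (norm_nonneg _) two_ne_zero).1 hF') (by
      rw [← norm_pos_iff]
      by_contra! hle
      have := le_antisymm hle (norm_nonneg _)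
      rw [this] at hG
      nlinarith)
  have r1 : IsReparam (fun z => (f z, g z)) (fun z =>
      (mobius (toDisk (diskSqrt a)) (toDisk (diskSqrt (mobius a z))),
        mobius (toDisk (I * diskSqrt a)) (toDisk (I * diskSqrt (mobius a z))))) :=
    ⟨_, _, isHolomorphicAut_rotation hη,
      (isHolomorphicAut_rotation hc).prodMap (isHolomorphicAut_rotation hd),
      fun z hz => Prod.ext (e1 hz) (e2 hz)⟩
  have r2 := isReparam_center isIsometryPair_sqrt.mapsTo₁ isIsometryPair_sqrt.mapsTo₂ ha
  simp only [← sqrtEmbedding_eq] at r2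
  exact r1.trans r2

/-- The classification of centered isometries. -/
theorem IsCenteredIsometry.classification {l₁ l₂ : ℝ} (hl₁ : 0 < l₁) (hl₂ : 0 < l₂) {f g : ℂ → ℂ}
    (h : IsCenteredIsometry l₁ l₂ f g) :
    (l₁ = 1 ∧ IsReparam (fun z => (f z, g z)) (fun z => (z, 0))) ∨
    (l₂ = 1 ∧ IsReparam (fun z => (f z, g z)) (fun z => (0, z))) ∨
    (l₁ + l₂ = 1 ∧ IsReparam (fun z => (f z, g z)) (fun z => (z, z))) ∨
    (l₁ = 1 ∧ l₂ = 1 ∧ IsReparam (fun z => (f z, g z)) sqrtEmbedding) := by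
  by_cases hf : deriv f 0 = 0
  · obtain ⟨hl, e1, c, hc, e2⟩ := h.of_deriv_eq_zero hl₁ hl₂ hf
    exact Or.inr <| Or.inl ⟨hl, id, _, isHolomorphicAut_id _,
      (isHolomorphicAut_id _).prodMap (isHolomorphicAut_rotation hc),
      fun z hz => Prod.ext (e1 hz) (e2 hz)⟩
  by_cases hg : deriv g 0 = 0
  · obtain ⟨hl, e1, c, hc, e2⟩ := h.symm.of_deriv_eq_zero hl₂ hl₁ hg
    exact Or.inl ⟨hl, id, _, isHolomorphicAut_id _,
      (isHolomorphicAut_rotation hc).prodMap (isHolomorphicAut_id _),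
      fun z hz => Prod.ext (e2 hz) (e1 hz)⟩
  by_cases hf2 : deriv (deriv f) 0 = 0
  · obtain ⟨hl, a, b, ha, hb, e1, e2⟩ := h.of_deriv_deriv_eq_zero hl₁ hl₂ hf hg hf2
    exact Or.inr <| Or.inr <| Or.inl ⟨hl, id, _, isHolomorphicAut_id _,
      (isHolomorphicAut_rotation ha).prodMap (isHolomorphicAut_rotation hb),
      fun z hz => Prod.ext (e1 hz) (e2 hz)⟩
  · obtain ⟨rfl, rfl⟩ := h.weights_eq_one hl₁ hl₂ hf hg hf2
    exact Or.inr <| Or.inr <| Or.inr ⟨rfl, rfl, h.isReparam_sqrt hf hg hf2⟩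

end DiskIsometry

end

theorem mainTheorem3 (l₁ l₂ : ℝ) (hl₁ : 0 < l₁) (hl₂ : 0 < l₂) (f : ℂ → ℂ × ℂ)
    (hf : DiskIsometry.IsHolomorphicIsometry l₁ l₂ f) :
    (l₁ = 1 ∧ DiskIsometry.EqUpToReparam l₁ l₂ f (fun z => (z, 0))) ∨
    (l₂ = 1 ∧ DiskIsometry.EqUpToReparam l₁ l₂ f (fun z => (0, z))) ∨
    (l₁ + l₂ = 1 ∧ DiskIsometry.EqUpToReparam l₁ l₂ f (fun z => (z, z))) ∨
    (l₁ = 1 ∧ l₂ = 1 ∧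
      DiskIsometry.EqUpToReparam l₁ l₂ f DiskIsometry.sqrtEmbedding) := by
  have h := DiskIsometry.isHolomorphicIsometry_iff.1 hf
  have r := DiskIsometry.isReparam_of_center h.mapsTo₁ h.mapsTo₂ DiskIsometry.zero_mem_disk
  rcases (h.center DiskIsometry.zero_mem_disk).classification hl₁ hl₂ with
    ⟨rfl, k⟩ | ⟨rfl, k⟩ | ⟨hl, k⟩ | ⟨rfl, rfl, k⟩
  · exact Or.inl ⟨rfl, hf, DiskIsometry.isHolomorphicIsometry_fst l₂, r.trans k⟩
  · exact Or.inr <| Or.inl ⟨rfl, hf, DiskIsometry.isHolomorphicIsometry_snd l₁, r.trans k⟩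
  · exact Or.inr <| Or.inr <| Or.inl
      ⟨hl, hf, DiskIsometry.isHolomorphicIsometry_diag hl, r.trans k⟩
  · exact Or.inr <| Or.inr <| Or.inr
      ⟨rfl, rfl, hf, DiskIsometry.isHolomorphicIsometry_sqrt, r.trans k⟩
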